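/- Let $G=(V,E)$ be an infinite, connected, simple planar graph of bounded degree, embedded in the plane $\mathbb C$ with straight, non-crossing edges; vertices are identified with their images, and edges do not accumulate at any point of the drawing. A face is a connected component of the complement of the drawing that is bounded by edges of $G$. Assume that the embedding is good: there are $D\in(1,\infty)$ and $\eta>0$ such that (a) every face is a convex polygon, bounded by a cycle of $G$, all of whose inner angles are at most $\pi-\eta$, and (b) $|u-w|/|u-v|\in[D^{-1},D]$ for any two edges $(u,v)$, $(u,w)$ with a common endpoint. Assume that the carrier of the embedding, i.e. the union of all its closed faces, is the open unit disc $U$. Let $(w_e)_{e\in E}$ be positive edge weights bounded above and away from $0$ (for instance $w\equiv 1$, which gives the simple random walk), and let $(X_n)_{n\ge0}$ be the random walk on $V$ started at a fixed vertex, with transition probabilities $P(X_{n+1}=u\mid X_n=v)=w_{(v,u)}/\sum_{z\sim v}w_{(v,z)}$ for $u\sim v$. Assume that this walk is transient. Then $X_n$ converges almost surely in $\mathbb C$ to a random point $X_\infty\in\partial U$, and the law of $X_\infty$ has no atoms, i.e. $\mathbb P(X_\infty=\xi)=0$ for every $\xi\in\partial U$. -/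

import Mathlib

open Filter Topology MeasureTheory

noncomputable section

namespace GoodEmbedding

variable {V : Type*}

/-- The straight segment drawn for the (potential) edge `e`, when every vertex `v` is placed at the
point `pos v` of the plane. -/
def edgeSegment (pos : V → ℂ) (e : Sym2 V) : Set ℂ :=
  convexHull ℝ (pos '' {v | v ∈ e})

/-- The drawing of the graph: the union of all its edges (as segments of the plane). -/
def drawing (G : SimpleGraph V) (pos : V → ℂ) : Set ℂ :=
  ⋃ e ∈ G.edgeSet, edgeSegment pos e

/-- An embedding of `G` in the plane with straight lines: distinct vertices go to distinct points,
and two distinct edges meet only at the image of a common endpoint. The last field says that the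
embedding is a topological one (a homeomorphism onto its image): edges do not accumulate at a point
of the drawing. -/
structure IsStraightLineEmbedding (G : SimpleGraph V) (pos : V → ℂ) : Prop where
  injective : Function.Injective pos
  noncrossing : ∀ e ∈ G.edgeSet, ∀ f ∈ G.edgeSet, e ≠ f →
    edgeSegment pos e ∩ edgeSegment pos f ⊆ pos '' {v | v ∈ e ∧ v ∈ f}
  locallyFinite : ∀ z ∈ drawing G pos, ∃ N ∈ 𝓝 z,
    {e ∈ G.edgeSet | (edgeSegment pos e ∩ N).Nonempty}.Finite

/-- A face: a connected component of the complement of the drawing which is bounded by edges of the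
graph. (For an infinite graph, the last condition leaves out the part of the plane that lies
beyond the accumulation points of the drawing, such as the exterior of the disc for a graph that
fills the disc. An unbounded component that is bounded by edges is a face.) -/
def IsFace (G : SimpleGraph V) (pos : V → ℂ) (F : Set ℂ) : Prop :=
  (∃ z ∈ (drawing G pos)ᶜ, F = connectedComponentIn (drawing G pos)ᶜ z) ∧
    frontier F ⊆ drawing G pos

/-- `F` is a convex polygon, bounded by a cycle of the graph, all of whose inner angles are at most
`θ`. (The inner angles of a convex polygon are the unoriented angles between consecutive sides.) -/
def IsConvexPolygonWithAngles (G : SimpleGraph V) (pos : V → ℂ) (θ : ℝ) (F : Set ℂ) : Prop :=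
  Convex ℝ F ∧ ∃ (n : ℕ) (c : Fin (n + 3) → V), Function.Injective c ∧
    (∀ i, G.Adj (c i) (c (i + 1))) ∧
    frontier F = ⋃ i, edgeSegment pos s(c i, c (i + 1)) ∧
    ∀ i, EuclideanGeometry.angle (pos (c i)) (pos (c (i + 1))) (pos (c (i + 2))) ≤ θ

/-- A `(D, η)`-good embedding. -/
structure IsGoodWith (G : SimpleGraph V) (pos : V → ℂ) (D η : ℝ) : Prop where
  one_lt : 1 < D
  pos_eta : 0 < η
  straight : IsStraightLineEmbedding G pos
  /-- No flat angles; in particular the faces are convex and there is no outer face. -/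
  noFlatAngles : ∀ F, IsFace G pos F → IsConvexPolygonWithAngles G pos (Real.pi - η) F
  /-- Adjacent edges have comparable lengths. -/
  comparable : ∀ u v w, G.Adj u v → G.Adj u w →
    dist (pos u) (pos w) / dist (pos u) (pos v) ∈ Set.Icc D⁻¹ D

/-- A good embedding. -/
def IsGood (G : SimpleGraph V) (pos : V → ℂ) : Prop :=
  ∃ D η : ℝ, IsGoodWith G pos D η

/-- The carrier: the union of all the (closed) faces. -/
def carrier (G : SimpleGraph V) (pos : V → ℂ) : Set ℂ :=
  ⋃ F ∈ {F | IsFace G pos F}, closure F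

/-- The total weight `w_v` of the edges at `v`. -/
def vertexWeight (G : SimpleGraph V) [G.LocallyFinite] (w : Sym2 V → ℝ) (v : V) : ℝ :=
  ∑ u ∈ G.neighborFinset v, w s(v, u)

open Classical in
/-- The transition probabilities of the weighted random walk. -/
def transition (G : SimpleGraph V) [G.LocallyFinite] (w : Sym2 V → ℝ) (v u : V) : ℝ :=
  if G.Adj v u then w s(v, u) / vertexWeight G w v else 0

open Classical in
/-- The `n`-step transition probabilities of the weighted random walk. -/
def transitionIter (G : SimpleGraph V) [G.LocallyFinite] (w : Sym2 V → ℝ) : ℕ → V → V → ℝ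
  | 0, v, u => if v = u then 1 else 0
  | n + 1, v, u => ∑ z ∈ G.neighborFinset v, transition G w v z * transitionIter G w n z u

/-- The weighted random walk is transient: the expected number of returns to any vertex is
finite. -/
def IsTransient (G : SimpleGraph V) [G.LocallyFinite] (w : Sym2 V → ℝ) : Prop :=
  ∀ v, Summable fun n => transitionIter G w n v v

open Classical in
/-- `X` is a weighted random walk on `G` started at `v₀`, on the probability space `(Ω, P)`. -/
structure IsRandomWalk (G : SimpleGraph V) [G.LocallyFinite] (w : Sym2 V → ℝ) (v₀ : V)
    {Ω : Type*} [MeasurableSpace Ω] (P : Measure Ω) (X : ℕ → Ω → V) : Prop where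
  measurable : ∀ n v, MeasurableSet {ω | X n ω = v}
  law : ∀ (n : ℕ) (x : ℕ → V), P {ω | ∀ k ≤ n, X k ω = x k} =
    if x 0 = v₀ then ENNReal.ofReal (∏ k ∈ Finset.range n, transition G w (x k) (x (k + 1))) else 0

end GoodEmbedding

end

noncomputable section

namespace GoodEmbedding

/-! ### Plane geometry of faces, edges and the carrier -/

section

variable {V : Type*} {G : SimpleGraph V} {pos : V → ℂ}

/-! The proof plays a bound on Dirichlet energy, which comes from area, against the decay of the
tail of the Green function.

Geometry. A face with a corner at `v` is convex, has an angle at most π − η there and has sides of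
comparable length. It therefore contains every point of its corner at distance below a fixed
multiple of the edge lengths at `v`. Hence each vertex has an isolating disc of that size, inside
the carrier (`IsGoodWith.exists_isolation_const`). The discs of half the radius are disjoint, so the
sum of squared edge lengths over the vertices in a region is bounded by the area
(`exists_edge_scale`). Lipschitz functions of the position thus have finite energy. A cutoff at
scale r around a boundary point has energy bounded uniformly in r: its squared slope r⁻² cancels
against the area r².

Probability. Let f have energy E, and run the walk from time m under an arbitrary killing rule. The
expected total increment of f is minus half of the energy form of f and h, where h is the expected
occupation time divided by the vertex weight. By Cauchy–Schwarz and reversibility it is at most the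
square root of E times `greenTail` at m (`sq_sum_increment_le`), which tends to 0 by transience.

This has two uses. Stopping at the first zero of a truncated coordinate and at the next time when it
equals 1 shows that crossings after time m have probability tending to 0, so both coordinates of the
walk converge (`IsRandomWalk.ae_exists_tendsto`). The limit lies on the circle, because a transient
walk leaves every finite set and vertices do not accumulate in the disc. For atoms, a cutoff around
ξ so narrow that it vanishes on everything reachable by time m has small expectation at all later
times, uniformly in its width (`IsRandomWalk.measure_tendsto_eq_zero`). -/

theorem edgeSegment_mk (pos : V → ℂ) (u v : V) :
    edgeSegment pos s(u, v) = segment ℝ (pos u) (pos v) := by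
  have : {x | x ∈ s(u, v)} = ({u, v} : Set V) := by ext x; simp
  rw [edgeSegment, this, Set.image_pair, convexHull_pair]

theorem segment_subset_drawing {u v : V} (h : G.Adj u v) :
    segment ℝ (pos u) (pos v) ⊆ drawing G pos := by
  rw [← edgeSegment_mk]
  exact Set.subset_biUnion_of_mem (u := fun e => edgeSegment pos e) (G.mem_edgeSet.2 h)

namespace IsFace

variable {F : Set ℂ}

theorem subset_compl (hF : IsFace G pos F) : F ⊆ (drawing G pos)ᶜ := by
  obtain ⟨⟨z, -, rfl⟩, -⟩ := hF
  exact connectedComponentIn_subset _ _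

theorem isOpen (hF : IsFace G pos F) : IsOpen F := by
  rw [← disjoint_frontier_iff_isOpen, Set.disjoint_left]
  exact fun x hx hxF => hF.subset_compl hxF (hF.2 hx)

theorem subset_of_isPreconnected (hF : IsFace G pos F) {S : Set ℂ} (hS : IsPreconnected S)
    (hSd : S ⊆ (drawing G pos)ᶜ) {y : ℂ} (hyS : y ∈ S) (hyF : y ∈ F) : S ⊆ F := by
  obtain ⟨⟨z, hz, rfl⟩, -⟩ := hF
  rw [connectedComponentIn_eq hyF]
  exact hS.subset_connectedComponentIn hyS hSd

theorem mem_frontier (hF : IsFace G pos F) {y : ℂ} (hy : y ∈ closure F)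
    (hyd : y ∈ drawing G pos) : y ∈ frontier F := by
  rw [hF.isOpen.frontier_eq]
  exact ⟨hy, fun h => hF.subset_compl h hyd⟩

end IsFace

theorem mem_carrier_iff {z : ℂ} :
    z ∈ carrier G pos ↔ ∃ F, IsFace G pos F ∧ z ∈ closure F := by
  simp [carrier]

theorem exists_adj_of_isGoodWith {D η : ℝ} (h : IsGoodWith G pos D η) (hconn : G.Connected)
    (hne : (carrier G pos).Nonempty) (v : V) : ∃ u, G.Adj v u := by
  obtain ⟨z, hz⟩ := hne
  obtain ⟨F, hF, -⟩ := mem_carrier_iff.1 hz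
  obtain ⟨-, n, c, -, hadj, -⟩ := h.noFlatAngles F hF
  have : Nontrivial V := ⟨⟨_, _, (hadj 0).ne⟩⟩
  exact hconn.preconnected.exists_adj_of_nontrivial v

theorem eta_le_pi {D η : ℝ} (h : IsGoodWith G pos D η)
    (hne : (carrier G pos).Nonempty) : η ≤ Real.pi := by
  obtain ⟨z, hz⟩ := hne
  obtain ⟨F, hF, -⟩ := mem_carrier_iff.1 hz
  obtain ⟨-, n, c, -, -, -, hang⟩ := h.noFlatAngles F hF
  have h1 := EuclideanGeometry.angle_nonneg (pos (c 0)) (pos (c (0 + 1))) (pos (c (0 + 2)))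
  linarith [hang 0]

/-- The embedding axioms constrain only edges, so the vertex `v` is tested through an edge at `v`,
which non-crossing compares with `e`. -/
theorem IsStraightLineEmbedding.mem_edge_of_pos_mem (h : IsStraightLineEmbedding G pos)
    {e : Sym2 V} (he : e ∈ G.edgeSet) {v u : V} (hvu : G.Adj v u)
    (hv : pos v ∈ edgeSegment pos e) : v ∈ e := by
  by_cases hef : e = s(v, u)
  · simp [hef]
  · have hv' : pos v ∈ edgeSegment pos s(v, u) := by
      rw [edgeSegment_mk]; exact left_mem_segment _ _ _
    obtain ⟨x, hx, hxv⟩ := h.noncrossing e he _ (G.mem_edgeSet.2 hvu) hef ⟨hv, hv'⟩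
    rw [← h.injective hxv]
    exact hx.1

/-- The boundary of a face is a union of whole edges. The one through `y` must be the given edge,
since two distinct edges never meet at an interior point of either. -/
theorem IsGoodWith.segment_subset_frontier {D η : ℝ} (h : IsGoodWith G pos D η) {F : Set ℂ}
    (hF : IsFace G pos F) {u v : V} (huv : G.Adj u v) {y : ℂ}
    (hy : y ∈ openSegment ℝ (pos u) (pos v)) (hyF : y ∈ closure F) :
    segment ℝ (pos u) (pos v) ⊆ frontier F := by
  have hyd : y ∈ segment ℝ (pos u) (pos v) := openSegment_subset_segment _ _ _ hy
  have hyf := hF.mem_frontier hyF (segment_subset_drawing huv hyd)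
  obtain ⟨-, n, c, -, hadj, hfr, -⟩ := h.noFlatAngles F hF
  have hyf' := hyf
  rw [hfr] at hyf'
  obtain ⟨i, hi⟩ := Set.mem_iUnion.1 hyf'
  by_cases hef : s(u, v) = s(c i, c (i + 1))
  · rw [hfr, ← edgeSegment_mk, hef]
    exact Set.subset_iUnion (fun i => edgeSegment pos s(c i, c (i + 1))) i
  · exfalso
    rw [← edgeSegment_mk] at hyd
    obtain ⟨x, hx, hxy⟩ := h.straight.noncrossing _ (G.mem_edgeSet.2 huv) _
      (G.mem_edgeSet.2 (hadj i)) hef ⟨hyd, hi⟩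
    have hne : pos u ≠ pos v := fun h' => huv.ne (h.straight.injective h')
    rcases Sym2.mem_iff.1 hx.1 with rfl | rfl
    · rw [← hxy, left_mem_openSegment_iff] at hy
      exact hne hy
    · rw [← hxy, right_mem_openSegment_iff] at hy
      exact hne hy

theorem closure_subset_carrier {F : Set ℂ} (hF : IsFace G pos F) :
    closure F ⊆ carrier G pos :=
  Set.subset_biUnion_of_mem (u := fun F => closure F) hF

/-- Openness of the carrier puts a point just after `u` on the edge into some closed face, and the
boundary of that face then contains the entire edge. This propagates membership in the carrier along
the graph. -/
theorem IsGoodWith.segment_subset_carrier {D η : ℝ} (h : IsGoodWith G pos D η)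
    (hopen : IsOpen (carrier G pos)) {u v : V} (huv : G.Adj u v) (hu : pos u ∈ carrier G pos) :
    segment ℝ (pos u) (pos v) ⊆ carrier G pos := by
  have hcont : Tendsto (fun t : ℝ => AffineMap.lineMap (pos u) (pos v) t) (𝓝[>] 0)
      (𝓝 (pos u)) := by
    have : Continuous (fun t : ℝ => AffineMap.lineMap (pos u) (pos v) t) :=
      AffineMap.lineMap_continuous
    have h2 := this.tendsto 0
    simp only [AffineMap.lineMap_apply_zero] at h2
    exact h2.mono_left nhdsWithin_le_nhds
  obtain ⟨t, ht, ht0, ht1⟩ := ((hcont.eventually (hopen.mem_nhds hu)).and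
    (Ioo_mem_nhdsGT (zero_lt_one' ℝ))).exists
  obtain ⟨F, hF, hyF⟩ := mem_carrier_iff.1 ht
  have hseg := h.segment_subset_frontier hF huv
    (by rw [openSegment_eq_image_lineMap]; exact ⟨t, ⟨ht0, ht1⟩, rfl⟩) hyF
  exact hseg.trans (frontier_subset_closure.trans (closure_subset_carrier hF))

theorem IsGoodWith.pos_mem_carrier {D η : ℝ} (h : IsGoodWith G pos D η) (hconn : G.Connected)
    (hopen : IsOpen (carrier G pos)) (hne : (carrier G pos).Nonempty) (v : V) :
    pos v ∈ carrier G pos := by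
  obtain ⟨z, hz⟩ := hne
  obtain ⟨F, hF, -⟩ := mem_carrier_iff.1 hz
  obtain ⟨-, n, c, -, hadj, hfr, -⟩ := h.noFlatAngles F hF
  have h0 : pos (c 0) ∈ carrier G pos := by
    apply closure_subset_carrier hF
    apply frontier_subset_closure
    rw [hfr]
    refine Set.mem_iUnion.2 ⟨0, ?_⟩
    rw [edgeSegment_mk]
    exact left_mem_segment _ _ _
  obtain ⟨p⟩ := hconn.preconnected (c 0) v
  have key : ∀ {a b : V}, G.Walk a b → pos a ∈ carrier G pos → pos b ∈ carrier G pos := by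
    intro a b p
    induction p with
    | nil => exact id
    | cons hab _ ih =>
      exact fun ha => ih (h.segment_subset_carrier hopen hab ha (right_mem_segment _ _ _))
  exact key p h0

theorem exists_smul_add_smul_of_det_ne_zero {P Q : ℂ}
    (hdet : P.re * Q.im - P.im * Q.re ≠ 0) (d : ℂ) : ∃ α β : ℝ, d = α • P + β • Q := by
  refine ⟨(d.re * Q.im - d.im * Q.re) / (P.re * Q.im - P.im * Q.re),
    (P.re * d.im - P.im * d.re) / (P.re * Q.im - P.im * Q.re), ?_⟩
  apply Complex.ext
  · simp only [Complex.add_re, Complex.smul_re, smul_eq_mul]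
    rw [div_mul_eq_mul_div, div_mul_eq_mul_div, ← add_div, eq_div_iff hdet]; ring
  · simp only [Complex.add_im, Complex.smul_im, smul_eq_mul]
    rw [div_mul_eq_mul_div, div_mul_eq_mul_div, ← add_div, eq_div_iff hdet]; ring

theorem exists_smul_of_det_eq_zero {P Q : ℂ} (hP : P ≠ 0)
    (hdet : P.re * Q.im - P.im * Q.re = 0) : ∃ s : ℝ, Q = s • P := by
  have hn : P.re ^ 2 + P.im ^ 2 ≠ 0 := by
    intro h0
    apply hP
    have h1 : P.re = 0 := by nlinarith [sq_nonneg P.re, sq_nonneg P.im]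
    have h2 : P.im = 0 := by nlinarith [sq_nonneg P.re, sq_nonneg P.im]
    exact Complex.ext h1 h2
  refine ⟨(P.re * Q.re + P.im * Q.im) / (P.re ^ 2 + P.im ^ 2), ?_⟩
  apply Complex.ext
  · simp only [Complex.smul_re, smul_eq_mul]; field_simp; linear_combination (-P.im) * hdet
  · simp only [Complex.smul_im, smul_eq_mul]; field_simp; linear_combination (P.re) * hdet

/-- In a convex cone of angle bounded away from `π`, the coordinates are controlled. -/
theorem sq_norm_combo_ge {P Q : ℂ} {k m α β : ℝ} (hk : -k * (‖P‖ * ‖Q‖) ≤ inner ℝ P Q)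
    (hk1 : k < 1) (hk2 : -1 ≤ k) (hα : 0 ≤ α) (hβ : 0 ≤ β) (hm : 0 ≤ m) (hmP : m ≤ ‖P‖) (hmQ : m ≤ ‖Q‖) :
    (1 - k) / 2 * ((α + β) * m) ^ 2 ≤ ‖α • P + β • Q‖ ^ 2 := by
  rw [norm_add_sq_real, inner_smul_left, inner_smul_right, norm_smul, norm_smul,
    Real.norm_of_nonneg hα, Real.norm_of_nonneg hβ]
  simp only [conj_trivial]
  have h1 : (α + β) * m ≤ α * ‖P‖ + β * ‖Q‖ := by nlinarith
  have h2 : ((α + β) * m) ^ 2 ≤ (α * ‖P‖ + β * ‖Q‖) ^ 2 := by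
    apply pow_le_pow_left₀ (by positivity) h1
  have h3 : α * β * (-k * (‖P‖ * ‖Q‖)) ≤ α * β * inner ℝ P Q :=
    mul_le_mul_of_nonneg_left hk (by positivity)
  have h4 : (1 - k) / 2 * ((α + β) * m) ^ 2 ≤ (1 - k) / 2 * (α * ‖P‖ + β * ‖Q‖) ^ 2 :=
    mul_le_mul_of_nonneg_left h2 (by linarith)
  have h5 : 0 ≤ (1 + k) / 2 * (α * ‖P‖ - β * ‖Q‖) ^ 2 :=
    mul_nonneg (by linarith) (sq_nonneg _)
  nlinarith

theorem _root_.Convex.add_smul_add_smul_mem {S : Set ℂ} (hS : Convex ℝ S) {v P Q : ℂ} {a b : ℝ}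
    (ha : 0 ≤ a) (hb : 0 ≤ b) (hab : a + b ≤ 1) (hv : v ∈ S) (hP : v + P ∈ S) (hQ : v + Q ∈ S) :
    v + (a • P + b • Q) ∈ S := by
  rcases (add_nonneg ha hb).eq_or_lt with h0 | h0
  · have ha0 : a = 0 := by linarith
    have hb0 : b = 0 := by linarith
    simpa [ha0, hb0] using hv
  · have hr := hS hP hQ (a := a / (a + b)) (b := b / (a + b)) (by positivity) (by positivity)
      (by field_simp)
    have := hS hv hr (a := 1 - (a + b)) (b := a + b) (by linarith) h0.le (by ring)
    convert this using 1
    have h1 : (a + b) * (a / (a + b)) = a := by field_simp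
    have h2 : (a + b) * (b / (a + b)) = b := by field_simp
    rw [smul_add (a + b), smul_smul, smul_smul, h1, h2]
    module

/-- If a coordinate were negative, mixing the point of `F` with a point of the closed triangle `v`,
`v + P`, `v + Q` would cancel the negative parts. The result lies in the open set `F`, yet also on
one of the two sides, which `F` avoids. -/
theorem cone_coords_nonneg {F : Set ℂ} (hFo : IsOpen F) (hFc : Convex ℝ F) {v P Q : ℂ}
    {t α β : ℝ} (ht : 0 < t) (hy : v + t • (α • P + β • Q) ∈ F) (hv : v ∈ closure F)
    (hP : v + P ∈ closure F) (hQ : v + Q ∈ closure F)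
    (hPF : ∀ s ∈ Set.Icc (0 : ℝ) 1, v + s • P ∉ F) (hQF : ∀ s ∈ Set.Icc (0 : ℝ) 1, v + s • Q ∉ F) :
    0 ≤ α ∧ 0 ≤ β := by
  by_contra hcon
  have hα : α = α⁺ - α⁻ := (posPart_sub_negPart α).symm
  have hβ : β = β⁺ - β⁻ := (posPart_sub_negPart β).symm
  have hA := posPart_nonneg α
  have hA' := negPart_nonneg α
  have hB := posPart_nonneg β
  have hB' := negPart_nonneg β
  have hor : α⁺ = 0 ∨ β⁺ = 0 := by
    by_contra! hne
    apply hcon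
    constructor
    · by_contra! h; exact hne.1 (posPart_eq_zero.2 h.le)
    · by_contra! h; exact hne.2 (posPart_eq_zero.2 h.le)
  have hS' : 0 < α⁻ + β⁻ := by
    by_contra! h
    apply hcon
    constructor <;> linarith
  generalize α⁺ = A at *
  generalize α⁻ = A' at *
  generalize β⁺ = B at *
  generalize β⁻ = B' at *
  have hT : 0 < A + B + (A' + B') := by linarith
  have hw : v + ((A' / (A + B + (A' + B'))) • P + (B' / (A + B + (A' + B'))) • Q) ∈ closure F := by
    refine hFc.closure.add_smul_add_smul_mem (by positivity) (by positivity) ?_ hv hP hQ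
    rw [← add_div, div_le_one hT]; linarith
  -- This weight makes `1 - l = l * t * (A + B + (A' + B'))`, so the triangle point contributes
  -- exactly the negative parts with opposite sign.
  set l : ℝ := 1 / (1 + t * (A + B + (A' + B'))) with hl
  have hden : 0 < 1 + t * (A + B + (A' + B')) := by positivity
  have hl0 : 0 < l := by positivity
  have h1l : 1 - l = l * t * (A + B + (A' + B')) := by rw [hl]; field_simp; ring
  have hl1 : 0 ≤ 1 - l := by rw [h1l]; positivity
  have hx := hFc.combo_interior_closure_mem_interior (hFo.interior_eq.symm ▸ hy) hw hl0 hl1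
    (by ring)
  rw [hFo.interior_eq] at hx
  have hx' : v + ((l * t * A) • P + (l * t * B) • Q) ∈ F := by
    convert hx using 1
    have e1 : (1 - l) * (A' / (A + B + (A' + B'))) = l * t * A' := by rw [h1l]; field_simp
    have e2 : (1 - l) * (B' / (A + B + (A' + B'))) = l * t * B' := by rw [h1l]; field_simp
    rw [smul_add (1 - l), smul_add (1 - l), smul_smul (1 - l), smul_smul (1 - l), e1, e2, hα, hβ]
    module
  have hle : l * t * (A + B) ≤ 1 := by
    have : 0 ≤ l * t * (A' + B') := by positivity
    nlinarith
  rcases hor with h0 | h0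
  · subst h0
    refine hQF (l * t * B) ⟨by positivity, by simpa using hle⟩ ?_
    simpa using hx'
  · subst h0
    refine hPF (l * t * A) ⟨by positivity, by simpa using hle⟩ ?_
    simpa using hx'

/-- By local finiteness only edges ending at `v` matter near `v`, and these lie on rays in
directions different from `d`. -/
theorem eventually_notMem_drawing (h : IsStraightLineEmbedding G pos) {v u₀ : V}
    (hvu : G.Adj v u₀) {d : ℂ} (hd : d ≠ 0)
    (hdir : ¬ ∃ u, ∃ s : ℝ, G.Adj v u ∧ 0 < s ∧ d = s • (pos u - pos v)) :
    ∀ᶠ t : ℝ in 𝓝[>] 0, pos v + t • d ∉ drawing G pos := by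
  obtain ⟨N, hN, hfin⟩ := h.locallyFinite (pos v)
    (segment_subset_drawing hvu (left_mem_segment _ _ _))
  have hev : ∀ᶠ x in 𝓝 (pos v), ∀ e ∈ {e ∈ G.edgeSet | (edgeSegment pos e ∩ N).Nonempty},
      v ∉ e → x ∉ edgeSegment pos e := by
    rw [eventually_all_finite hfin]
    intro e he
    by_cases hve : v ∈ e
    · simp [hve]
    · have hcl : IsClosed (edgeSegment pos e) := by
        refine Set.Finite.isClosed_convexHull (𝕜 := ℝ) (Set.Finite.image _ ?_)
        induction e with
        | h a b =>
          have : {x | x ∈ s(a, b)} = ({a, b} : Set V) := by ext x; simp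
          rw [this]; exact Set.toFinite _
      have hmem : pos v ∉ edgeSegment pos e := fun hm => hve (h.mem_edge_of_pos_mem he.1 hvu hm)
      filter_upwards [hcl.isOpen_compl.mem_nhds hmem] with x hx _ using hx
  have htend : Tendsto (fun t : ℝ => pos v + t • d) (𝓝[>] 0) (𝓝 (pos v)) := by
    have : Continuous (fun t : ℝ => pos v + t • d) := by fun_prop
    have h2 := this.tendsto 0
    simp only [zero_smul, add_zero] at h2
    exact h2.mono_left nhdsWithin_le_nhds
  filter_upwards [htend.eventually hev, htend.eventually hN, self_mem_nhdsWithin]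
    with t ht htN ht0 hdr
  simp only [Set.mem_Ioi] at ht0
  simp only [drawing, Set.mem_iUnion] at hdr
  obtain ⟨e, he, hye⟩ := hdr
  have hve : v ∈ e := by
    by_contra hve
    exact ht e ⟨he, _, hye, htN⟩ hve hye
  obtain ⟨u, rfl⟩ := Sym2.mem_iff_exists.1 hve
  rw [edgeSegment_mk, segment_eq_image'] at hye
  obtain ⟨s, hs, hs'⟩ := hye
  have hs2 : s • (pos u - pos v) = t • d := by simpa using hs'
  have hs0 : s ≠ 0 := by
    rintro rfl
    rw [zero_smul, eq_comm, smul_eq_zero] at hs2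
    exact hs2.elim ht0.ne' hd
  refine hdir ⟨u, s / t, G.mem_edgeSet.1 he, div_pos (lt_of_le_of_ne hs.1 hs0.symm) ht0, ?_⟩
  rw [div_eq_inv_mul, mul_smul, hs2, inv_smul_smul₀ ht0.ne']

end

/-! ### Isolating discs around vertices and their packing -/

section

variable {V : Type*} {G : SimpleGraph V} {pos : V → ℂ}

/-- Two edges at a vertex never point in the same direction. -/
theorem IsStraightLineEmbedding.not_same_direction (h : IsStraightLineEmbedding G pos) {v p q : V}
    (hp : G.Adj v p) (hq : G.Adj v q) (hpq : p ≠ q) {s : ℝ} (hs : 0 < s) :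
    pos q - pos v ≠ s • (pos p - pos v) := by
  have aux : ∀ {p q : V}, G.Adj v p → G.Adj v q → p ≠ q → ∀ {s : ℝ}, 0 < s → s ≤ 1 →
      pos q - pos v ≠ s • (pos p - pos v) := by
    intro p q hp hq hpq s hs hs1 heq
    have hmem : pos q ∈ edgeSegment pos s(v, p) := by
      rw [edgeSegment_mk, segment_eq_image']
      exact ⟨s, ⟨hs.le, hs1⟩, by simp [← heq]⟩
    have := h.mem_edge_of_pos_mem (G.mem_edgeSet.2 hp) hq.symm hmem
    rcases Sym2.mem_iff.1 this with rfl | rfl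
    · exact hq.ne rfl
    · exact hpq rfl
  intro heq
  rcases le_total s 1 with hs1 | hs1
  · exact aux hp hq hpq hs hs1 heq
  · refine aux hq hp hpq.symm (inv_pos.2 hs) (inv_le_one_of_one_le₀ hs1) ?_
    rw [heq, inv_smul_smul₀ hs.ne']

/-- A point closer to the vertex `v` than a fixed multiple of the lengths of the edges at `v` lies
on one of these edges or in a face. -/
theorem IsGoodWith.mem_openSegment_or_mem_face {D η κ : ℝ} (h : IsGoodWith G pos D η)
    (hopen : IsOpen (carrier G pos)) {v u₀ : V} (hvu : G.Adj v u₀)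
    (hvU : pos v ∈ carrier G pos) (hcos : Real.cos η < 1)
    (hκ0 : 0 < κ) (hκ1 : κ ≤ 1) (hκ : κ ^ 2 ≤ (1 - Real.cos η) / 2) {z : ℂ} (hzv : z ≠ pos v)
    (hz : ∀ u, G.Adj v u → ‖z - pos v‖ < κ * ‖pos u - pos v‖) :
    (∃ u, G.Adj v u ∧ z ∈ openSegment ℝ (pos v) (pos u)) ∨ ∃ F, IsFace G pos F ∧ z ∈ F := by
  obtain ⟨d, rfl⟩ : ∃ d, z = pos v + d := ⟨z - pos v, by ring⟩
  simp only [add_sub_cancel_left] at hz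
  have hd : d ≠ 0 := by rintro rfl; simp at hzv
  by_cases hdir : ∃ u, ∃ s : ℝ, G.Adj v u ∧ 0 < s ∧ d = s • (pos u - pos v)
  · left
    obtain ⟨u, s, hu, hs, rfl⟩ := hdir
    refine ⟨u, hu, ?_⟩
    rw [openSegment_eq_image']
    refine ⟨s, ⟨hs, ?_⟩, rfl⟩
    have h1 := hz u hu
    rw [norm_smul, Real.norm_of_nonneg hs.le] at h1
    have h2 : 0 < ‖pos u - pos v‖ := norm_pos_iff.2 (sub_ne_zero.2 fun h' =>
      hu.ne (h.straight.injective h').symm)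
    exact (lt_of_mul_lt_mul_right h1 h2.le).trans_le hκ1
  right
  have hev := eventually_notMem_drawing h.straight hvu hd hdir
  have htend : Tendsto (fun t : ℝ => pos v + t • d) (𝓝[>] 0) (𝓝 (pos v)) := by
    have : Continuous (fun t : ℝ => pos v + t • d) := by fun_prop
    have h2 := this.tendsto 0
    simp only [zero_smul, add_zero] at h2
    exact h2.mono_left nhdsWithin_le_nhds
  obtain ⟨t₀, ht₀, hsub⟩ := mem_nhdsGT_iff_exists_Ioo_subset.1
    (hev.and ((htend.eventually (hopen.mem_nhds hvU)).and (Ioo_mem_nhdsGT (zero_lt_one' ℝ))))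
  simp only [Set.mem_Ioi] at ht₀
  have hcon : Set.Ioo 0 t₀ ⊆ {t : ℝ | pos v + t • d ∉ drawing G pos} := fun t ht => (hsub ht).1
  -- A sample point on the ray from `v` towards `z`, close enough to `v` to be off the drawing and
  -- in the carrier. It selects the face `F` whose corner at `v` the ray enters.
  obtain ⟨hy1, hy2, ht⟩ := hsub (⟨half_pos ht₀, half_lt_self ht₀⟩ : t₀ / 2 ∈ Set.Ioo 0 t₀)
  obtain ⟨F, hF, hyF'⟩ := mem_carrier_iff.1 hy2
  have hyF : pos v + (t₀ / 2) • d ∈ F := by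
    by_contra hyn
    apply hy1
    apply hF.2
    rw [hF.isOpen.frontier_eq]
    exact ⟨hyF', hyn⟩
  have hS : (fun t : ℝ => pos v + t • d) '' Set.Ioo 0 t₀ ⊆ F := by
    refine hF.subset_of_isPreconnected (isPreconnected_Ioo.image _ (by fun_prop)) ?_
      ⟨t₀ / 2, ⟨half_pos ht₀, half_lt_self ht₀⟩, rfl⟩ hyF
    rintro _ ⟨t, ht, rfl⟩
    exact hcon ht
  have hvF : pos v ∈ closure F := by
    refine mem_closure_of_tendsto htend ?_
    filter_upwards [Ioo_mem_nhdsGT ht₀] with t ht using hS ⟨t, ht, rfl⟩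
  have hvfr := hF.mem_frontier hvF (segment_subset_drawing hvu (left_mem_segment _ _ _))
  obtain ⟨hconv, n, c, hc, hadj, hfr, hang⟩ := h.noFlatAngles F hF
  have hsegfr : ∀ i, segment ℝ (pos (c i)) (pos (c (i + 1))) ⊆ frontier F := by
    intro i
    rw [hfr, ← edgeSegment_mk]
    exact Set.subset_iUnion (fun i => edgeSegment pos s(c i, c (i + 1))) i
  obtain ⟨j, rfl⟩ : ∃ j, v = c (j + 1) := by
    rw [hfr] at hvfr
    obtain ⟨i, hi⟩ := Set.mem_iUnion.1 hvfr
    rcases Sym2.mem_iff.1 (h.straight.mem_edge_of_pos_mem (G.mem_edgeSet.2 (hadj i)) hvu hi)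
      with h' | h'
    · exact ⟨i - 1, by rw [sub_add_cancel, h']⟩
    · exact ⟨i, h'⟩
  have e2 : j + 1 + 1 = j + 2 := by rw [add_assoc]; congr 1
  have hadjp : G.Adj (c (j + 1)) (c j) := (hadj j).symm
  have hadjq : G.Adj (c (j + 1)) (c (j + 2)) := e2 ▸ hadj (j + 1)
  -- The cycle has length at least 3, so 2 is nonzero in `Fin (n + 3)`.
  have hpq : c j ≠ c (j + 2) := by
    intro h'
    have := hc h'
    rw [eq_comm, add_eq_left] at this
    simp [Fin.ext_iff, Nat.mod_eq_of_lt (show 2 < n + 3 by omega)] at this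
  have hangj := hang j
  have hsp := hsegfr j
  have hsq := hsegfr (j + 1)
  rw [e2] at hsq
  rw [segment_symm] at hsp
  generalize c (j + 1) = v at *
  generalize c j = p at *
  generalize c (j + 2) = q at *
  rw [EuclideanGeometry.angle, vsub_eq_sub, vsub_eq_sub] at hangj
  have hzp := hz p hadjp
  have hzq := hz q hadjq
  have hpvec : pos v + (pos p - pos v) = pos p := by ring
  have hqvec : pos v + (pos q - pos v) = pos q := by ring
  have hnsame := fun s hs => h.straight.not_same_direction hadjp hadjq hpq (s := s) hs
  have hP0 : pos p - pos v ≠ 0 := sub_ne_zero.2 fun h' => hadjp.ne (h.straight.injective h').symm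
  have hQ0 : pos q - pos v ≠ 0 := sub_ne_zero.2 fun h' => hadjq.ne (h.straight.injective h').symm
  have hPcl : pos v + (pos p - pos v) ∈ closure F := by
    rw [hpvec]; exact frontier_subset_closure (hsp (right_mem_segment _ _ _))
  have hQcl : pos v + (pos q - pos v) ∈ closure F := by
    rw [hqvec]; exact frontier_subset_closure (hsq (right_mem_segment _ _ _))
  have hPF : ∀ s ∈ Set.Icc (0 : ℝ) 1, pos v + s • (pos p - pos v) ∉ F := by
    intro s hs hsF
    have : pos v + s • (pos p - pos v) ∈ frontier F := by
      apply hsp; rw [segment_eq_image']; exact ⟨s, hs, rfl⟩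
    rw [hF.isOpen.frontier_eq] at this
    exact this.2 hsF
  have hQF : ∀ s ∈ Set.Icc (0 : ℝ) 1, pos v + s • (pos q - pos v) ∉ F := by
    intro s hs hsF
    have : pos v + s • (pos q - pos v) ∈ frontier F := by
      apply hsq; rw [segment_eq_image']; exact ⟨s, hs, rfl⟩
    rw [hF.isOpen.frontier_eq] at this
    exact this.2 hsF
  generalize pos p - pos v = P at *
  generalize pos q - pos v = Q at *
  have hinner : -Real.cos η * (‖P‖ * ‖Q‖) ≤ inner ℝ P Q := by
    rw [← InnerProductGeometry.cos_angle_mul_norm_mul_norm, ← Real.cos_pi_sub]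
    refine mul_le_mul_of_nonneg_right ?_ (by positivity)
    exact Real.cos_le_cos_of_nonneg_of_le_pi (InnerProductGeometry.angle_nonneg _ _)
      (by linarith [h.pos_eta]) hangj
  -- Parallel sides would either point the same way, which non-crossing forbids, or form a flat
  -- angle, which the bound π − η forbids.
  have hdet : P.re * Q.im - P.im * Q.re ≠ 0 := by
    intro h0
    obtain ⟨s, rfl⟩ := exists_smul_of_det_eq_zero hP0 h0
    rcases lt_trichotomy s 0 with hs | rfl | hs
    · rw [inner_smul_right, norm_smul, real_inner_self_eq_norm_sq, Real.norm_of_nonpos hs.le]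
        at hinner
      have : 0 < ‖P‖ ^ 2 := by positivity
      nlinarith [mul_pos (mul_pos (neg_pos.2 hs) this) (sub_pos.2 hcos)]
    · simp at hQ0
    · exact hnsame s hs rfl
  obtain ⟨α, β, rfl⟩ := exists_smul_add_smul_of_det_ne_zero hdet d
  obtain ⟨hα, hβ⟩ := cone_coords_nonneg hF.isOpen hconv (half_pos ht₀) hyF hvF hPcl hQcl hPF hQF
  -- Being within κ times the shorter side keeps `z` strictly on the near side of the chord joining
  -- `p` and `q`; this is where κ² ≤ (1 − cos η)/2 enters.
  have hab : α + β < 1 := by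
    have hm0 : 0 < min ‖P‖ ‖Q‖ := lt_min (norm_pos_iff.2 hP0) (norm_pos_iff.2 hQ0)
    have h1 := sq_norm_combo_ge hinner hcos (Real.neg_one_le_cos η) hα hβ hm0.le
      (min_le_left _ _) (min_le_right _ _)
    have h2 : ‖α • P + β • Q‖ < κ * min ‖P‖ ‖Q‖ := by
      rcases min_choice ‖P‖ ‖Q‖ with h' | h' <;> rw [h'] <;> assumption
    have h3 : ‖α • P + β • Q‖ ^ 2 < (κ * min ‖P‖ ‖Q‖) ^ 2 :=
      pow_lt_pow_left₀ h2 (norm_nonneg _) (by norm_num)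
    have h4 : (κ * ((α + β) * min ‖P‖ ‖Q‖)) ^ 2 < (κ * min ‖P‖ ‖Q‖) ^ 2 := by
      refine lt_of_le_of_lt ?_ h3
      rw [mul_pow]
      exact (mul_le_mul_of_nonneg_right hκ (sq_nonneg _)).trans h1
    have h5 := lt_of_pow_lt_pow_left₀ 2 (by positivity) h4
    have h6 := lt_of_mul_lt_mul_left h5 hκ0.le
    nlinarith
  have hab0 : 0 < α + β := by
    refine lt_of_le_of_ne (add_nonneg hα hβ) fun h0 => hd ?_
    have ha0 : α = 0 := by linarith
    have hb0 : β = 0 := by linarith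
    simp [ha0, hb0]
  refine ⟨F, hF, ?_⟩
  -- The ray meets the chord here. The point `z` lies between the sample point, interior to `F`, and
  -- this point of the closure, hence in `F`.
  have hend : pos v + ((α / (α + β)) • P + (β / (α + β)) • Q) ∈ closure F :=
    hconv.closure.add_smul_add_smul_mem (by positivity) (by positivity)
      (by rw [← add_div, div_self hab0.ne']) hvF hPcl hQcl
  have hden : 0 < (α + β)⁻¹ - t₀ / 2 := by
    have : 1 < (α + β)⁻¹ := (one_lt_inv₀ hab0).2 hab
    linarith [ht.2]
  have := hconv.combo_interior_closure_mem_interior (hF.isOpen.interior_eq.symm ▸ hyF) hend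
    (a := ((α + β)⁻¹ - 1) / ((α + β)⁻¹ - t₀ / 2)) (b := (1 - t₀ / 2) / ((α + β)⁻¹ - t₀ / 2))
    (div_pos (by linarith [(one_lt_inv₀ hab0).2 hab]) hden)
    (div_nonneg (by linarith [ht.2]) hden.le) (by rw [← add_div, div_eq_one_iff_eq hden.ne']; ring)
  rw [hF.isOpen.interior_eq] at this
  convert this using 1
  simp only [smul_add, smul_smul]
  generalize hr : (α + β)⁻¹ = r at *
  have hr0 : r - t₀ / 2 ≠ 0 := hden.ne'
  have c1 : (r - 1) / (r - t₀ / 2) + (1 - t₀ / 2) / (r - t₀ / 2) = 1 := by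
    rw [← add_div, div_eq_one_iff_eq hr0]; ring
  have c2 : (r - 1) / (r - t₀ / 2) * (t₀ / 2) + (1 - t₀ / 2) / (r - t₀ / 2) * r = 1 := by
    rw [div_mul_eq_mul_div, div_mul_eq_mul_div, ← add_div, div_eq_one_iff_eq hr0]; ring
  rw [div_eq_mul_inv α, div_eq_mul_inv β, hr]
  generalize (r - 1) / (r - t₀ / 2) = x at *
  generalize (1 - t₀ / 2) / (r - t₀ / 2) = y at *
  have e1 : y * (α * r) = (1 - x * (t₀ / 2)) * α := by rw [← c2]; ring
  have e3 : y * (β * r) = (1 - x * (t₀ / 2)) * β := by rw [← c2]; ring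
  have e4 : y = 1 - x := by linarith
  rw [e1, e3, e4]
  module

/-- Around each vertex there is a disc of radius comparable to the edges at this vertex which lies
in the carrier and contains no other vertex. -/
theorem IsGoodWith.exists_isolation_const {D η : ℝ} (h : IsGoodWith G pos D η)
    (hconn : G.Connected) (hopen : IsOpen (carrier G pos)) (hne : (carrier G pos).Nonempty) :
    ∃ κ > 0, ∀ v u, G.Adj v u → ∀ z, dist z (pos v) < κ * dist (pos v) (pos u) →
      z ∈ carrier G pos ∧ ∀ v', v' ≠ v → pos v' ≠ z := by
  have hηπ := eta_le_pi h hne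
  have hcos : Real.cos η < 1 := by
    rw [← Real.cos_zero]
    exact Real.cos_lt_cos_of_nonneg_of_le_pi le_rfl hηπ h.pos_eta
  have hD : 0 < D := zero_lt_one.trans h.one_lt
  set κ := Real.sqrt ((1 - Real.cos η) / 2) with hκdef
  have hκ0 : 0 < κ := Real.sqrt_pos.2 (by linarith)
  have hκsq : κ ^ 2 = (1 - Real.cos η) / 2 := Real.sq_sqrt (by linarith)
  have hκ1 : κ ≤ 1 := Real.sqrt_le_one.2 (by linarith [Real.neg_one_le_cos η])
  -- Dividing by `D` turns a bound by one edge at `v` into a bound by every edge at `v`.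
  refine ⟨κ / D, by positivity, fun v u₀ hvu z hz => ?_⟩
  have hvU := h.pos_mem_carrier hconn hopen hne v
  have hz' : ∀ u, G.Adj v u → ‖z - pos v‖ < κ * ‖pos u - pos v‖ := by
    intro u hu
    have h1 := (h.comparable v u u₀ hu hvu).2
    have hpos : 0 < dist (pos v) (pos u) :=
      dist_pos.2 fun h' => hu.ne (h.straight.injective h')
    rw [div_le_iff₀ hpos] at h1
    rw [← dist_eq_norm, ← dist_eq_norm, dist_comm (pos u)]
    calc dist z (pos v) < κ / D * dist (pos v) (pos u₀) := hz
      _ ≤ κ / D * (D * dist (pos v) (pos u)) := by gcongr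
      _ = κ * dist (pos v) (pos u) := by field_simp
  by_cases hzv : z = pos v
  · subst hzv
    exact ⟨hvU, fun v' hv' h' => hv' (h.straight.injective h')⟩
  rcases h.mem_openSegment_or_mem_face hopen hvu hvU hcos hκ0 hκ1 hκsq.le hzv hz' with
    ⟨u, hu, hzu⟩ | ⟨F, hF, hzF⟩
  · have hzs := openSegment_subset_segment _ _ _ hzu
    refine ⟨h.segment_subset_carrier hopen hu hvU hzs, ?_⟩
    rintro v' hv' rfl
    obtain ⟨u', hu'⟩ := exists_adj_of_isGoodWith h hconn hne v'
    rw [← edgeSegment_mk] at hzs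
    rcases Sym2.mem_iff.1 (h.straight.mem_edge_of_pos_mem (G.mem_edgeSet.2 hu) hu' hzs) with
      rfl | rfl
    · exact hv' rfl
    · rw [right_mem_openSegment_iff] at hzu
      exact hzv hzu.symm
  · refine ⟨closure_subset_carrier hF (subset_closure hzF), ?_⟩
    rintro v' hv' rfl
    obtain ⟨u', hu'⟩ := exists_adj_of_isGoodWith h hconn hne v'
    exact hF.subset_compl hzF (segment_subset_drawing hu' (left_mem_segment _ _ _))

/-- Comparison of areas, with the common factor π cancelled. -/
theorem sum_sq_le_of_pairwise_disjoint_ball {ι : Type*} (B : Finset ι) (c : ι → ℂ) (ρ : ι → ℝ)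
    (hρ : ∀ i ∈ B, 0 ≤ ρ i) {x : ℂ} {R : ℝ} (hR : 0 ≤ R)
    (hd : (B : Set ι).PairwiseDisjoint fun i => Metric.ball (c i) (ρ i))
    (hsub : ∀ i ∈ B, Metric.ball (c i) (ρ i) ⊆ Metric.ball x R) :
    ∑ i ∈ B, ρ i ^ 2 ≤ R ^ 2 := by
  have h1 : volume (⋃ i ∈ B, Metric.ball (c i) (ρ i)) ≤ volume (Metric.ball x R) :=
    measure_mono (Set.iUnion₂_subset hsub)
  rw [measure_biUnion_finset hd (fun i _ => measurableSet_ball)] at h1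
  simp only [Complex.volume_ball] at h1
  rw [← Finset.sum_mul, ENNReal.mul_le_mul_iff_left (by simp [NNReal.pi_ne_zero]) (by simp),
    ← ENNReal.ofReal_pow hR] at h1
  rw [Finset.sum_congr rfl fun i hi => (ENNReal.ofReal_pow (hρ i hi) 2).symm,
    ← ENNReal.ofReal_sum_of_nonneg (fun i _ => sq_nonneg _)] at h1
  exact (ENNReal.ofReal_le_ofReal_iff (sq_nonneg R)).1 h1

end

/-! ### Packing bounds for edge lengths -/

section

variable {V : Type*} {G : SimpleGraph V} {w : Sym2 V → ℝ} {pos : V → ℂ}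

/-- A length scale `s` for the edges at each vertex, with the packing bounds that come from
disjoint discs around the vertices. -/
theorem exists_edge_scale {D η : ℝ} (h : IsGoodWith G pos D η) (hconn : G.Connected)
    (hcarr : carrier G pos = Metric.ball (0 : ℂ) 1) :
    ∃ (s : V → ℝ) (C : ℝ), 0 ≤ C ∧ (∀ x y, G.Adj x y → dist (pos x) (pos y) ≤ s x) ∧
      (∀ B : Finset V, ∑ v ∈ B, s v ^ 2 ≤ C) ∧
      ∀ ξ ∉ Metric.ball (0 : ℂ) 1, ∀ R > 0, ∀ B : Finset V, (∀ v ∈ B, dist (pos v) ξ < R) →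
        ∑ v ∈ B, s v ^ 2 ≤ C * R ^ 2 := by
  have hopen : IsOpen (carrier G pos) := hcarr ▸ Metric.isOpen_ball
  have hne : (carrier G pos).Nonempty := hcarr ▸ ⟨0, by simp⟩
  obtain ⟨κ, hκ, hiso⟩ := h.exists_isolation_const hconn hopen hne
  choose nb hnb using exists_adj_of_isGoodWith h hconn hne
  have hD : 0 < D := zero_lt_one.trans h.one_lt
  set ℓ : V → ℝ := fun v => dist (pos v) (pos (nb v)) with hℓ
  have hℓpos : ∀ v, 0 < ℓ v := fun v =>
    dist_pos.2 fun h' => (hnb v).ne (h.straight.injective h')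
  have hsub : ∀ v, Metric.ball (pos v) (κ * ℓ v) ⊆ Metric.ball 0 1 := fun v z hz =>
    hcarr ▸ (hiso v _ (hnb v) z hz).1
  have hsep : ∀ v v', v' ≠ v → κ * ℓ v ≤ dist (pos v') (pos v) := by
    intro v v' hne
    by_contra! hlt
    exact (hiso v _ (hnb v) (pos v') hlt).2 v' hne rfl
  have hdisj : ∀ B : Finset V,
      (B : Set V).PairwiseDisjoint fun v => Metric.ball (pos v) (κ * ℓ v / 2) := by
    intro B v _ v' _ hvv'
    apply Metric.ball_disjoint_ball
    have h1 := hsep v v' hvv'.symm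
    have h2 := hsep v' v hvv'
    rw [dist_comm] at h1
    linarith
  have hpack : ∀ (B : Finset V) (x : ℂ) (R : ℝ), 0 ≤ R →
      (∀ v ∈ B, Metric.ball (pos v) (κ * ℓ v / 2) ⊆ Metric.ball x R) →
      ∑ v ∈ B, (D * ℓ v) ^ 2 ≤ (2 * D / κ) ^ 2 * R ^ 2 := by
    intro B x R hR hB
    have := sum_sq_le_of_pairwise_disjoint_ball B pos (fun v => κ * ℓ v / 2)
      (fun v _ => by have := hℓpos v; positivity) hR (hdisj B) hB
    calc ∑ v ∈ B, (D * ℓ v) ^ 2 = (2 * D / κ) ^ 2 * ∑ v ∈ B, (κ * ℓ v / 2) ^ 2 := by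
          rw [Finset.mul_sum]
          refine Finset.sum_congr rfl fun v _ => ?_
          field_simp
      _ ≤ _ := by gcongr
  -- The scale `D * ℓ v` bounds all edges at `v`. The factor `2 ^ 2` pays for enlarging the radius
  -- `R` to `2 * R` in the last bound.
  refine ⟨fun v => D * ℓ v, (2 * D / κ) ^ 2 * 2 ^ 2, by positivity, ?_, ?_, ?_⟩
  · intro x y hxy
    have h1 := (h.comparable x (nb x) y (hnb x) hxy).2
    rwa [div_le_iff₀ (hℓpos x)] at h1
  · intro B
    refine (hpack B 0 1 zero_le_one fun v _ => ?_).trans ?_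
    · refine (Metric.ball_subset_ball ?_).trans (hsub v)
      nlinarith [hℓpos v, mul_pos hκ (hℓpos v)]
    · have : 0 ≤ (2 * D / κ) ^ 2 := by positivity
      nlinarith
  · intro ξ hξ R hR B hB
    rw [mul_assoc, ← mul_pow]
    refine hpack B ξ (2 * R) (by positivity) fun v hv => ?_
    apply Metric.ball_subset_ball'
    -- The isolating disc stays in the unit disc and so misses `ξ`. Discs centred near `ξ` are
    -- therefore small enough to fit in the ball of radius `2 * R`.
    have h1 : κ * ℓ v ≤ dist (pos v) ξ := by
      by_contra! hlt
      exact hξ (hsub v (by rwa [Metric.mem_ball, dist_comm]))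
    have := hB v hv
    linarith

/-! ### Dirichlet energy -/

open Classical in
/-- The weights as a symmetric function on pairs of vertices. -/
def conductance (G : SimpleGraph V) (w : Sym2 V → ℝ) (x y : V) : ℝ :=
  if G.Adj x y then w s(x, y) else 0

theorem conductance_comm (G : SimpleGraph V) (w : Sym2 V → ℝ) (x y : V) :
    conductance G w x y = conductance G w y x := by
  by_cases h : G.Adj x y
  · simp only [conductance, h, h.symm, if_true, Sym2.eq_swap]
  · simp only [conductance, h, mt G.adj_symm h, if_false]

/-- The Dirichlet energy of `f` (every edge counted twice) is at most `E`. -/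
def EnergyLE (G : SimpleGraph V) (w : Sym2 V → ℝ) (f : V → ℝ) (E : ℝ) : Prop :=
  ∀ B : Finset V, ∑ x ∈ B, ∑ y ∈ B, conductance G w x y * (f y - f x) ^ 2 ≤ E

/-- Summation by parts. There is no boundary term because both sums run over the symmetric set of
pairs in `B`. -/
theorem sum_conductance_mul_sub (B : Finset V) (h g : V → ℝ) :
    ∑ x ∈ B, ∑ y ∈ B, conductance G w x y * (h x * (g y - g x)) =
      -(1 / 2) * ∑ x ∈ B, ∑ y ∈ B, conductance G w x y * ((h y - h x) * (g y - g x)) := by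
  have h1 : ∑ x ∈ B, ∑ y ∈ B, conductance G w x y * (h x * (g y - g x)) =
      ∑ x ∈ B, ∑ y ∈ B, conductance G w x y * (h y * (g x - g y)) := by
    rw [Finset.sum_comm]
    refine Finset.sum_congr rfl fun x _ => Finset.sum_congr rfl fun y _ => ?_
    rw [conductance_comm]
  have h2 : ∑ x ∈ B, ∑ y ∈ B, conductance G w x y * ((h y - h x) * (g y - g x)) =
      -(∑ x ∈ B, ∑ y ∈ B, conductance G w x y * (h y * (g x - g y))) -
      ∑ x ∈ B, ∑ y ∈ B, conductance G w x y * (h x * (g y - g x)) := by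
    simp only [← Finset.sum_neg_distrib, ← Finset.sum_sub_distrib]
    refine Finset.sum_congr rfl fun x _ => Finset.sum_congr rfl fun y _ => ?_
    ring
  rw [h2, ← h1]; ring

theorem sq_sum_conductance_le (hw : ∀ e ∈ G.edgeSet, 0 < w e) (B : Finset V) (h g : V → ℝ) :
    (∑ x ∈ B, ∑ y ∈ B, conductance G w x y * ((h y - h x) * (g y - g x))) ^ 2 ≤
      (∑ x ∈ B, ∑ y ∈ B, conductance G w x y * (h y - h x) ^ 2) *
        ∑ x ∈ B, ∑ y ∈ B, conductance G w x y * (g y - g x) ^ 2 := by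
  have hc : ∀ x y, 0 ≤ conductance G w x y := by
    intro x y
    unfold conductance
    split_ifs with h
    · exact (hw _ (G.mem_edgeSet.2 h)).le
    · exact le_rfl
  simp only [← Finset.sum_product']
  refine Finset.sum_sq_le_sum_mul_sum_of_sq_le_mul _ (fun p _ => ?_) (fun p _ => ?_)
    fun p _ => le_of_eq ?_
  · have := hc p.1 p.2; positivity
  · have := hc p.1 p.2; positivity
  · ring

-- An edge on which `f` varies has an endpoint in `T` and is charged to it. Each vertex `x` receives
-- at most `d` charges of size `b * L ^ 2 * s x ^ 2`; the factor 2 accounts for ordered pairs.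
open Classical in
theorem energyLE_of_lipschitz [G.LocallyFinite] {b : ℝ} {d : ℕ}
    (hd : ∀ v, G.degree v ≤ d) (hb : ∀ e ∈ G.edgeSet, 0 ≤ w e ∧ w e ≤ b) {s : V → ℝ}
    (hs : ∀ x y, G.Adj x y → dist (pos x) (pos y) ≤ s x) {f : V → ℝ} {L M : ℝ} (hb0 : 0 ≤ b)
    {T : Set V} (hf : ∀ x y, G.Adj x y → |f y - f x| ≤ L * dist (pos x) (pos y))
    (hL : 0 ≤ L) (hT : ∀ x y, x ∉ T → y ∉ T → f x = f y)
    (hM : ∀ B : Finset V, (∀ v ∈ B, v ∈ T) → ∑ v ∈ B, s v ^ 2 ≤ M) :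
    EnergyLE G w f (2 * (d * (b * L ^ 2 * M))) := by
  intro B
  set g : V → V → ℝ := fun x y => if G.Adj x y ∧ x ∈ T then b * L ^ 2 * s x ^ 2 else 0 with hg
  have hg0 : ∀ x y, 0 ≤ g x y := by
    intro x y; simp only [hg]; split_ifs <;> positivity
  have key : ∀ x y, G.Adj x y → w s(x, y) * (f y - f x) ^ 2 ≤ b * L ^ 2 * s x ^ 2 := by
    intro x y hxy
    have h1 : (f y - f x) ^ 2 ≤ (L * s x) ^ 2 := by
      rw [← sq_abs]
      exact pow_le_pow_left₀ (abs_nonneg _) ((hf x y hxy).trans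
        (mul_le_mul_of_nonneg_left (hs x y hxy) hL)) 2
    calc _ ≤ b * (L * s x) ^ 2 := mul_le_mul (hb _ (G.mem_edgeSet.2 hxy)).2 h1 (sq_nonneg _) hb0
      _ = _ := by ring
  have hle : ∀ x y, conductance G w x y * (f y - f x) ^ 2 ≤ g x y + g y x := by
    intro x y
    by_cases hxy : G.Adj x y
    · by_cases hx : x ∈ T
      · have := key x y hxy
        have h2 := hg0 y x
        have h3 : g x y = b * L ^ 2 * s x ^ 2 := by simp [hg, hxy, hx]
        simp only [conductance, hxy, if_true]
        linarith
      · by_cases hy : y ∈ T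
        · have := key y x hxy.symm
          have h2 := hg0 x y
          have h3 : g y x = b * L ^ 2 * s y ^ 2 := by simp [hg, hxy.symm, hy]
          simp only [conductance, hxy, if_true]
          rw [Sym2.eq_swap, ← neg_sub, neg_sq]
          linarith
        · have h2 := hg0 x y
          have h3 := hg0 y x
          rw [hT x y hx hy]
          simp only [sub_self]
          linarith
    · have h2 := hg0 x y
      have h3 := hg0 y x
      simp only [conductance, hxy, if_false, zero_mul]
      linarith
  have hsum : ∑ x ∈ B, ∑ y ∈ B, g x y ≤ d * (b * L ^ 2 * M) := by
    calc ∑ x ∈ B, ∑ y ∈ B, g x y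
        ≤ ∑ x ∈ B, if x ∈ T then d * (b * L ^ 2 * s x ^ 2) else 0 := by
          refine Finset.sum_le_sum fun x _ => ?_
          by_cases hx : x ∈ T
          · have h1 : ∑ y ∈ B, g x y ≤ ∑ y ∈ G.neighborFinset x, b * L ^ 2 * s x ^ 2 := by
              have h2 : ∑ y ∈ B, g x y = ∑ y ∈ B with G.Adj x y, b * L ^ 2 * s x ^ 2 := by
                rw [Finset.sum_filter]
                simp [hg, hx]
              rw [h2]
              refine Finset.sum_le_sum_of_subset_of_nonneg (fun y hy => ?_)
                fun _ _ _ => by positivity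
              simpa using (Finset.mem_filter.1 hy).2
            rw [if_pos hx]
            refine h1.trans ?_
            rw [Finset.sum_const, nsmul_eq_mul, G.card_neighborFinset_eq_degree]
            have := hd x
            gcongr
          · simp [hg, hx]
      _ = d * (b * L ^ 2 * ∑ x ∈ B with x ∈ T, s x ^ 2) := by
          rw [Finset.sum_filter, Finset.mul_sum, Finset.mul_sum]
          refine Finset.sum_congr rfl fun x _ => ?_
          split_ifs <;> simp
      _ ≤ _ := by
          have := hM {x ∈ B | x ∈ T} (by simp)
          gcongr
  calc _ ≤ ∑ x ∈ B, ∑ y ∈ B, (g x y + g y x) :=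
        Finset.sum_le_sum fun x _ => Finset.sum_le_sum fun y _ => hle x y
    _ = ∑ x ∈ B, ∑ y ∈ B, g x y + ∑ x ∈ B, ∑ y ∈ B, g x y := by
        simp only [Finset.sum_add_distrib]
        congr 1
        rw [Finset.sum_comm]
    _ ≤ _ := by linarith

end

/-! ### Reversibility and the energy bound for increments -/

section

variable {V : Type*} {G : SimpleGraph V} [G.LocallyFinite] {w : Sym2 V → ℝ}

open Classical in
/-- The vertices at graph distance at most `n` from `v₀`. -/
def graphBall (G : SimpleGraph V) [G.LocallyFinite] (v₀ : V) : ℕ → Finset V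
  | 0 => {v₀}
  | n + 1 => graphBall G v₀ n ∪ (graphBall G v₀ n).biUnion fun x => G.neighborFinset x

theorem graphBall_mono {v₀ : V} : Monotone (graphBall G v₀) := by
  classical
  exact monotone_nat_of_le_succ fun _ => Finset.subset_union_left

theorem mem_graphBall_succ {v₀ x y : V} {n : ℕ} (hx : x ∈ graphBall G v₀ n) (hxy : G.Adj x y) :
    y ∈ graphBall G v₀ (n + 1) := by
  classical
  exact Finset.mem_union_right _ (Finset.mem_biUnion.2 ⟨x, hx, by simpa using hxy⟩)

theorem exists_mem_graphBall (hconn : G.Connected) (v₀ v : V) : ∃ n, v ∈ graphBall G v₀ n := by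
  have key : ∀ {a b : V}, G.Walk a b → (∃ n, a ∈ graphBall G v₀ n) →
      ∃ n, b ∈ graphBall G v₀ n := by
    intro a b p
    induction p with
    | nil => exact id
    | cons hab _ ih => exact fun ⟨n, hn⟩ => ih ⟨n + 1, mem_graphBall_succ hn hab⟩
  obtain ⟨p⟩ := hconn.preconnected v₀ v
  exact key p ⟨0, Finset.mem_singleton_self _⟩

theorem countable_of_connected (hconn : G.Connected) : Countable V := by
  obtain ⟨v₀⟩ := hconn.nonempty
  have : (⋃ n, (graphBall G v₀ n : Set V)) = Set.univ := by
    ext v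
    simpa using exists_mem_graphBall hconn v₀ v
  rw [← Set.countable_univ_iff, ← this]
  exact Set.countable_iUnion fun n => Finset.countable_toSet _

theorem transition_eq (x y : V) :
    transition G w x y = conductance G w x y / vertexWeight G w x := by
  by_cases h : G.Adj x y <;> simp [transition, conductance, h]

theorem sum_conductance (x : V) :
    ∑ y ∈ G.neighborFinset x, conductance G w x y = vertexWeight G w x :=
  Finset.sum_congr rfl fun y hy => by
    rw [conductance, if_pos (by simpa using hy)]

theorem sum_neighborFinset_eq {u : V → ℝ} {B : Finset V} {x : V}
    (h : ∀ z, G.Adj x z → u z ≠ 0 → z ∈ B) :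
    ∑ z ∈ G.neighborFinset x, conductance G w x z * u z = ∑ z ∈ B, conductance G w x z * u z := by
  classical
  have h1 : ∑ z ∈ B ∪ G.neighborFinset x, conductance G w x z * u z =
      ∑ z ∈ G.neighborFinset x, conductance G w x z * u z := by
    refine (Finset.sum_subset Finset.subset_union_right fun z _ hz => ?_).symm
    rw [conductance, if_neg (by simpa using hz), zero_mul]
  rw [← h1]
  refine (Finset.sum_subset Finset.subset_union_left fun z _ hz => ?_).symm
  by_cases hxz : G.Adj x z
  · rw [not_not.1 (mt (h z hxz) hz), mul_zero]
  · rw [conductance, if_neg hxz, zero_mul]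

theorem transition_nonneg (hw : ∀ e ∈ G.edgeSet, 0 < w e) (hπ : ∀ v, 0 < vertexWeight G w v)
    (x y : V) : 0 ≤ transition G w x y := by
  unfold transition
  split_ifs with h
  · exact div_nonneg (hw _ (G.mem_edgeSet.2 h)).le (hπ x).le
  · exact le_rfl

theorem transitionIter_nonneg (hw : ∀ e ∈ G.edgeSet, 0 < w e) (hπ : ∀ v, 0 < vertexWeight G w v)
    (n : ℕ) (x y : V) : 0 ≤ transitionIter G w n x y := by
  induction n generalizing x with
  | zero => simp only [transitionIter]; split_ifs <;> norm_num
  | succ n ih =>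
    exact Finset.sum_nonneg fun z _ => mul_nonneg (transition_nonneg hw hπ x z) (ih z)

theorem mem_graphBall_of_transitionIter_ne_zero {n : ℕ} {x v₀ : V}
    (h : transitionIter G w n x v₀ ≠ 0) : x ∈ graphBall G v₀ n := by
  induction n generalizing x with
  | zero =>
    simp only [transitionIter, ne_eq, ite_eq_right_iff, one_ne_zero, imp_false, not_not] at h
    simp [graphBall, h]
  | succ n ih =>
    obtain ⟨z, hz, hne⟩ := Finset.exists_ne_zero_of_sum_ne_zero h
    exact mem_graphBall_succ (ih (right_ne_zero_of_mul hne)) (by simpa using G.adj_symm (by simpa using hz))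

theorem vertexWeight_mul_sum_transition (hπ : ∀ v, 0 < vertexWeight G w v) (x : V) (u : V → ℝ) :
    vertexWeight G w x * ∑ z ∈ G.neighborFinset x, transition G w x z * u z =
      ∑ z ∈ G.neighborFinset x, conductance G w x z * u z := by
  rw [Finset.mul_sum]
  refine Finset.sum_congr rfl fun z _ => ?_
  rw [transition_eq, ← mul_assoc, mul_div_cancel₀ _ (hπ x).ne']

/-- Reversibility: weighting by `vertexWeight` replaces transition probabilities by the symmetric
conductances. -/
theorem sum_transition_self_adjoint (hπ : ∀ v, 0 < vertexWeight G w v) {B : Finset V}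
    {u v : V → ℝ} (hu : ∀ x, u x ≠ 0 → x ∈ B) (hv : ∀ x, v x ≠ 0 → x ∈ B) :
    ∑ x ∈ B, vertexWeight G w x * (∑ z ∈ G.neighborFinset x, transition G w x z * u z) * v x =
      ∑ x ∈ B, vertexWeight G w x * (∑ z ∈ G.neighborFinset x, transition G w x z * v z) * u x := by
  simp only [vertexWeight_mul_sum_transition hπ]
  simp only [sum_neighborFinset_eq (u := u) fun z _ => hu z,
    sum_neighborFinset_eq (u := v) fun z _ => hv z, Finset.sum_mul]
  rw [Finset.sum_comm]
  refine Finset.sum_congr rfl fun x _ => Finset.sum_congr rfl fun y _ => ?_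
  rw [conductance_comm]; ring

/-- Self-adjointness moves the `m` steps of one factor onto the other, one at a time. Supports stay
in graph balls, so the finite set `B` loses nothing. -/
theorem sum_transitionIter_mul (hπ : ∀ v, 0 < vertexWeight G w v) {v₀ : V} {m k : ℕ}
    {B : Finset V} (hB : graphBall G v₀ (m + k) ⊆ B) :
    ∑ x ∈ B, vertexWeight G w x * transitionIter G w m x v₀ * transitionIter G w k x v₀ =
      vertexWeight G w v₀ * transitionIter G w (m + k) v₀ v₀ := by
  induction m generalizing k with
  | zero =>
    have hv₀ : v₀ ∈ B := hB (graphBall_mono (Nat.zero_le _) (Finset.mem_singleton_self _))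
    rw [Finset.sum_eq_single_of_mem v₀ hv₀ fun x _ hx => by simp [transitionIter, hx]]
    simp [transitionIter]
  | succ m ih =>
    have h1 := sum_transition_self_adjoint hπ (B := B) (u := fun x => transitionIter G w m x v₀)
      (v := fun x => transitionIter G w k x v₀)
      (fun x hx => hB (graphBall_mono (by omega) (mem_graphBall_of_transitionIter_ne_zero hx)))
      (fun x hx => hB (graphBall_mono (by omega) (mem_graphBall_of_transitionIter_ne_zero hx)))
    have h2 := ih (k := k + 1) (by rwa [show m + (k + 1) = m + 1 + k by ring])
    rw [show m + 1 + k = m + (k + 1) by ring, ← h2]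
    refine h1.trans (Finset.sum_congr rfl fun x _ => ?_)
    simp only [transitionIter]; ring

/-- The law of the walk started at `v₀`, expressed through return probabilities. -/
def occupation (G : SimpleGraph V) [G.LocallyFinite] (w : Sym2 V → ℝ) (v₀ : V) (n : ℕ) (x : V) : ℝ :=
  vertexWeight G w x / vertexWeight G w v₀ * transitionIter G w n x v₀

/-- One step of the walk, acting on masses. -/
def push (G : SimpleGraph V) [G.LocallyFinite] (w : Sym2 V → ℝ) (a : V → ℝ) (y : V) : ℝ :=
  ∑ x ∈ G.neighborFinset y, a x * transition G w x y

theorem push_mono (hw : ∀ e ∈ G.edgeSet, 0 < w e) (hπ : ∀ v, 0 < vertexWeight G w v)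
    {a b : V → ℝ} (hab : ∀ x, a x ≤ b x) (y : V) : push G w a y ≤ push G w b y :=
  Finset.sum_le_sum fun x _ => mul_le_mul_of_nonneg_right (hab x) (transition_nonneg hw hπ x y)

theorem occupation_succ (hπ : ∀ v, 0 < vertexWeight G w v) (v₀ : V) (n : ℕ) (y : V) :
    occupation G w v₀ (n + 1) y = push G w (occupation G w v₀ n) y := by
  simp only [occupation, push, transitionIter]
  rw [div_mul_eq_mul_div, vertexWeight_mul_sum_transition hπ, Finset.sum_div]
  refine Finset.sum_congr rfl fun x _ => ?_
  rw [transition_eq, conductance_comm]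
  have := (hπ x).ne'
  field_simp

theorem mem_graphBall_of_occupation_ne_zero {v₀ x : V} {n : ℕ}
    (h : occupation G w v₀ n x ≠ 0) : x ∈ graphBall G v₀ n :=
  mem_graphBall_of_transitionIter_ne_zero (right_ne_zero_of_mul h)

/-- Summability at `v₀` spreads along walks: a first step across an edge has positive probability,
so the series at its far end is dominated by a multiple of a shifted series at its near end. -/
theorem summable_occupation (hconn : G.Connected) (hw : ∀ e ∈ G.edgeSet, 0 < w e)
    (hπ : ∀ v, 0 < vertexWeight G w v) (htrans : IsTransient G w) (v₀ x : V) :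
    Summable fun n => occupation G w v₀ n x := by
  apply Summable.mul_left
  have key : ∀ {a b : V}, G.Walk a b → (Summable fun n => transitionIter G w n a v₀) →
      Summable fun n => transitionIter G w n b v₀ := by
    intro a b p
    induction p with
    | nil => exact id
    | @cons a b _ hab _ ih =>
      intro ha
      apply ih
      have hp : 0 < transition G w a b := by
        rw [transition, if_pos hab]
        exact div_pos (hw _ (G.mem_edgeSet.2 hab)) (hπ a)
      have h1 : Summable fun n => transition G w a b * transitionIter G w n b v₀ := by
        refine Summable.of_nonneg_of_le
          (fun n => mul_nonneg hp.le (transitionIter_nonneg hw hπ _ _ _)) (fun n => ?_)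
          ((summable_nat_add_iff 1).2 ha)
        exact Finset.single_le_sum (f := fun z => transition G w a z * transitionIter G w n z v₀)
          (fun z _ => mul_nonneg (transition_nonneg hw hπ a z) (transitionIter_nonneg hw hπ _ _ _))
          (by simpa using hab)
      exact (summable_mul_left_iff hp.ne').1 h1
  obtain ⟨p⟩ := hconn.preconnected v₀ x
  exact key p (htrans v₀)

/-- The expected increment of a function of finite energy along a walk that starts at time `m` and
is killed by an arbitrary rule is controlled by the tail of the Green function. -/
theorem sq_sum_increment_le (hw : ∀ e ∈ G.edgeSet, 0 < w e) (hπ : ∀ v, 0 < vertexWeight G w v)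
    {v₀ : V} (hsum : Summable fun n => transitionIter G w n v₀ v₀) {f : V → ℝ} {E : ℝ}
    (hf : EnergyLE G w f E) {a : ℕ → V → ℝ} {m N : ℕ} (ha0 : ∀ k x, 0 ≤ a k x)
    (ham : ∀ x, a m x ≤ occupation G w v₀ m x)
    (hstep : ∀ k, m ≤ k → ∀ y, a (k + 1) y ≤ push G w (a k) y) {B : Finset V}
    (hB : graphBall G v₀ (N + m + 1) ⊆ B) :
    (∑ k ∈ Finset.Ico m N, ∑ x ∈ B, a k x *
      (∑ y ∈ G.neighborFinset x, transition G w x y * f y - f x)) ^ 2 ≤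
      E * ((∑' j, transitionIter G w (j + 2 * m) v₀ v₀) / vertexWeight G w v₀) := by
  have hocc : ∀ k, m ≤ k → ∀ x, a k x ≤ occupation G w v₀ k x := by
    intro k hk
    induction k, hk using Nat.le_induction with
    | base => exact ham
    | succ k hk ih =>
      intro x
      rw [occupation_succ hπ]
      exact (hstep k hk x).trans (push_mono hw hπ ih x)
  have hsupp : ∀ k, m ≤ k → ∀ x, a k x ≠ 0 → x ∈ graphBall G v₀ k := by
    intro k hk x hx
    refine mem_graphBall_of_occupation_ne_zero (w := w) fun h0 => hx ?_
    exact le_antisymm (h0 ▸ hocc k hk x) (ha0 k x)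
  set H : V → ℝ := fun x => ∑ k ∈ Finset.Ico m N, a k x with hH
  -- The expected time spent at each vertex, as a density with respect to the reversible measure;
  -- the sum to be bounded is a pairing of `h` with the increments of `f`.
  set h : V → ℝ := fun x => H x / vertexWeight G w x with hh
  have hH0 : ∀ x, 0 ≤ H x := fun x => Finset.sum_nonneg fun k _ => ha0 k x
  have hh0 : ∀ x, 0 ≤ h x := fun x => div_nonneg (hH0 x) (hπ x).le
  have hHh : ∀ x, H x = vertexWeight G w x * h x := fun x => by
    rw [hh]; field_simp [(hπ x).ne']
  have hhsupp : ∀ x, h x ≠ 0 → x ∈ graphBall G v₀ N := by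
    intro x hx
    have hx' : H x ≠ 0 := fun h0 => hx (by simp [hh, h0])
    obtain ⟨k, hk, hne⟩ := Finset.exists_ne_zero_of_sum_ne_zero hx'
    rw [Finset.mem_Ico] at hk
    exact graphBall_mono hk.2.le (hsupp k hk.1 x hne)
  have hhB : ∀ x, h x ≠ 0 → x ∈ B := fun x hx => hB (graphBall_mono (by omega) (hhsupp x hx))
  have hS : ∑ k ∈ Finset.Ico m N, ∑ x ∈ B, a k x *
      (∑ y ∈ G.neighborFinset x, transition G w x y * f y - f x) =
      ∑ x ∈ B, ∑ y ∈ B, conductance G w x y * (h x * (f y - f x)) := by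
    rw [Finset.sum_comm]
    refine Finset.sum_congr rfl fun x _ => ?_
    rw [← Finset.sum_mul]
    change H x * _ = _
    rw [hHh]
    by_cases hx : h x = 0
    · simp [hx]
    · have h1 : ∑ y ∈ B, conductance G w x y * (h x * (f y - f x)) =
          ∑ y ∈ G.neighborFinset x, conductance G w x y * (h x * (f y - f x)) := by
        refine (sum_neighborFinset_eq fun z hxz _ => ?_).symm
        exact hB (graphBall_mono (by omega) (mem_graphBall_succ (hhsupp x hx) hxz))
      rw [h1]
      calc _ = h x * (vertexWeight G w x * ∑ y ∈ G.neighborFinset x, transition G w x y * f y -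
            vertexWeight G w x * f x) := by ring
        _ = _ := by
            rw [vertexWeight_mul_sum_transition hπ, ← sum_conductance, Finset.sum_mul,
              ← Finset.sum_sub_distrib, Finset.mul_sum]
            exact Finset.sum_congr rfl fun y _ => by ring
  have htel : ∀ n, m ≤ n → ∀ x, ∑ k ∈ Finset.Ico m n, (a k x - push G w (a k) x) ≤
      a m x - a n x := by
    intro n hn
    induction n, hn using Nat.le_induction with
    | base => simp
    | succ n hn ih =>
      intro x
      rw [Finset.sum_Ico_succ_top hn]
      linarith [ih x, hstep n hn x]
  -- The density `h` satisfies a Poisson inequality: its source is at most the initial mass `a m`,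
  -- since killing only removes mass.
  have hpush : ∀ x, vertexWeight G w x * h x - ∑ y ∈ G.neighborFinset x, conductance G w x y * h y
      ≤ a m x := by
    intro x
    have h1 : ∑ y ∈ G.neighborFinset x, conductance G w x y * h y =
        ∑ k ∈ Finset.Ico m N, push G w (a k) x := by
      simp only [push]
      rw [Finset.sum_comm]
      refine Finset.sum_congr rfl fun y _ => ?_
      rw [← Finset.sum_mul, transition_eq, conductance_comm]
      simp only [hh, hH]
      ring
    rw [← hHh, h1]
    simp only [hH]
    rw [← Finset.sum_sub_distrib]
    rcases le_total m N with hmN | hmN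
    · linarith [htel N hmN x, ha0 N x]
    · rw [Finset.Ico_eq_empty_of_le hmN]; simpa using ha0 m x
  -- Test the Poisson inequality with `h` itself and sum by parts; the 2 comes from ordered pairs.
  have hEh : ∑ x ∈ B, ∑ y ∈ B, conductance G w x y * (h y - h x) ^ 2 ≤
      2 * ∑ x ∈ B, h x * a m x := by
    have h1 := sum_conductance_mul_sub (G := G) (w := w) B h h
    have h2 : ∑ x ∈ B, ∑ y ∈ B, conductance G w x y * (h x * (h y - h x)) ≥
        - ∑ x ∈ B, h x * a m x := by
      rw [← Finset.sum_neg_distrib]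
      refine Finset.sum_le_sum fun x _ => ?_
      by_cases hx : h x = 0
      · simp [hx]
      have h3 : ∑ y ∈ B, conductance G w x y * (h x * (h y - h x)) =
          ∑ y ∈ G.neighborFinset x, conductance G w x y * (h x * (h y - h x)) := by
        refine (sum_neighborFinset_eq fun z hxz _ => ?_).symm
        exact hB (graphBall_mono (by omega) (mem_graphBall_succ (hhsupp x hx) hxz))
      have h4 : ∑ y ∈ G.neighborFinset x, conductance G w x y * (h x * (h y - h x)) =
          -(h x * (vertexWeight G w x * h x -
            ∑ y ∈ G.neighborFinset x, conductance G w x y * h y)) := by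
        rw [← sum_conductance, Finset.sum_mul, ← Finset.sum_sub_distrib, Finset.mul_sum,
          ← Finset.sum_neg_distrib]
        exact Finset.sum_congr rfl fun y _ => by ring
      rw [h3, h4]
      exact neg_le_neg (mul_le_mul_of_nonneg_left (hpush x) (hh0 x))
    simp only [← sq] at h1
    linarith
  -- Dominate both factors by the unkilled walk. Each pairing of times `k` and `m` is a return
  -- probability at time `k + m`, and `k ≥ m` starts the tail at `2 * m`.
  have hha : ∑ x ∈ B, h x * a m x ≤
      (∑' j, transitionIter G w (j + 2 * m) v₀ v₀) / vertexWeight G w v₀ := by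
    have h1 : ∀ x, h x * a m x ≤ ∑ k ∈ Finset.Ico m N, (vertexWeight G w x *
        transitionIter G w k x v₀ * transitionIter G w m x v₀) / vertexWeight G w v₀ ^ 2 := by
      intro x
      have h2 : h x ≤ ∑ k ∈ Finset.Ico m N, occupation G w v₀ k x / vertexWeight G w x := by
        rw [← Finset.sum_div]
        refine div_le_div_of_nonneg_right ?_ (hπ x).le
        exact Finset.sum_le_sum fun k hk => hocc k (Finset.mem_Ico.1 hk).1 x
      calc h x * a m x ≤ (∑ k ∈ Finset.Ico m N, occupation G w v₀ k x / vertexWeight G w x) *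
            occupation G w v₀ m x :=
            mul_le_mul h2 (ham x) (ha0 m x) ((hh0 x).trans h2)
        _ = _ := by
            rw [Finset.sum_mul]
            refine Finset.sum_congr rfl fun k _ => ?_
            have h3 := (hπ x).ne'
            have h4 := (hπ v₀).ne'
            simp only [occupation]
            field_simp
    calc ∑ x ∈ B, h x * a m x ≤ ∑ x ∈ B, ∑ k ∈ Finset.Ico m N, (vertexWeight G w x *
        transitionIter G w k x v₀ * transitionIter G w m x v₀) / vertexWeight G w v₀ ^ 2 :=
          Finset.sum_le_sum fun x _ => h1 x
      _ = ∑ k ∈ Finset.Ico m N, transitionIter G w (k + m) v₀ v₀ / vertexWeight G w v₀ := by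
          rw [Finset.sum_comm]
          refine Finset.sum_congr rfl fun k hk => ?_
          have hk' := (Finset.mem_Ico.1 hk).2
          rw [← Finset.sum_div, sum_transitionIter_mul hπ
            ((graphBall_mono (by omega)).trans hB)]
          have h4 := (hπ v₀).ne'
          field_simp
      _ ≤ _ := by
          rw [← Finset.sum_div]
          refine div_le_div_of_nonneg_right ?_ (hπ v₀).le
          rw [Finset.sum_Ico_eq_sum_range]
          have h5 : ∀ j, transitionIter G w (m + j + m) v₀ v₀ =
              transitionIter G w (j + 2 * m) v₀ v₀ := fun j => by congr 1; ring
          simp only [h5]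
          exact ((summable_nat_add_iff (2 * m)).2 hsum).sum_le_tsum _
            fun j _ => transitionIter_nonneg hw hπ _ _ _
  have hCS := sq_sum_conductance_le hw B h f
  rw [hS, sum_conductance_mul_sub]
  have hE0 : 0 ≤ E := by simpa using hf ∅
  have h0 : 0 ≤ ∑ x ∈ B, h x * a m x :=
    Finset.sum_nonneg fun x _ => mul_nonneg (hh0 x) (ha0 m x)
  calc _ = 1 / 4 * (∑ x ∈ B, ∑ y ∈ B, conductance G w x y * ((h y - h x) * (f y - f x))) ^ 2 := by
        ring
    _ ≤ 1 / 4 * ((2 * ∑ x ∈ B, h x * a m x) * E) := by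
        refine mul_le_mul_of_nonneg_left (hCS.trans ?_) (by norm_num)
        exact (mul_le_mul_of_nonneg_right hEh (Finset.sum_nonneg fun x _ =>
          Finset.sum_nonneg fun y _ => mul_nonneg (by
            unfold conductance
            split_ifs with h
            · exact (hw _ (G.mem_edgeSet.2 h)).le
            · exact le_rfl) (sq_nonneg _))).trans
          (mul_le_mul_of_nonneg_left (hf B) (by linarith))
    _ ≤ E * ∑ x ∈ B, h x * a m x := by nlinarith [mul_nonneg hE0 h0]
    _ ≤ _ := mul_le_mul_of_nonneg_left hha hE0

end

/-! ### The walk as a process: cylinders, the Markov property and its marginals -/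

section

variable {V : Type*} {G : SimpleGraph V} [G.LocallyFinite] {w : Sym2 V → ℝ} {v₀ : V}

/-- A property of sequences that depends only on the terms up to the index `n`. -/
def DependsOnUpTo (n : ℕ) (Q : (ℕ → V) → Prop) : Prop :=
  ∀ x x' : ℕ → V, (∀ k ≤ n, x k = x' k) → Q x → Q x'

/-- The sequence with initial terms `s`, continued by the constant `z`. -/
def extendPath {n : ℕ} (s : Fin (n + 1) → V) (z : V) (k : ℕ) : V :=
  if h : k < n + 1 then s ⟨k, h⟩ else z

theorem extendPath_of_le {n k : ℕ} (s : Fin (n + 1) → V) (z : V) (h : k ≤ n) :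
    extendPath s z k = s ⟨k, Nat.lt_succ_of_le h⟩ :=
  dif_pos (Nat.lt_succ_of_le h)

theorem extendPath_succ {n : ℕ} (s : Fin (n + 1) → V) (z : V) : extendPath s z (n + 1) = z :=
  dif_neg (lt_irrefl _)

theorem setOf_eq_iUnion_cylinder {Ω : Type*} {X : ℕ → Ω → V} {n : ℕ} {Q : (ℕ → V) → Prop} (hQ : DependsOnUpTo n Q) (z : V) :
    {ω | Q fun k => X k ω} = ⋃ s : {s : Fin (n + 1) → V // Q (extendPath s z)},
      {ω | ∀ k ≤ n, X k ω = extendPath s.1 z k} := by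
  ext ω
  simp only [Set.mem_ofPred_eq, Set.mem_iUnion]
  constructor
  · intro h
    have heq : ∀ k ≤ n, X k ω = extendPath (fun i : Fin (n + 1) => X i ω) z k := fun k hk => by
      rw [extendPath_of_le _ _ hk]
    exact ⟨⟨fun i => X i ω, hQ _ _ heq h⟩, heq⟩
  · rintro ⟨s, hs⟩
    exact hQ _ _ (fun k hk => (hs k hk).symm) s.2

namespace IsRandomWalk

variable {Ω : Type*} [MeasurableSpace Ω] {P : Measure Ω} {X : ℕ → Ω → V}

theorem measurableSet_cylinder (hX : IsRandomWalk G w v₀ P X) (n : ℕ) (x : ℕ → V) :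
    MeasurableSet {ω | ∀ k ≤ n, X k ω = x k} := by
  have : {ω | ∀ k ≤ n, X k ω = x k} = ⋂ k, ⋂ _ : k ≤ n, {ω | X k ω = x k} := by ext; simp
  rw [this]
  exact MeasurableSet.iInter fun k => MeasurableSet.iInter fun _ => hX.measurable k _

theorem measurableSet_of_dependsOnUpTo [Countable V] (hX : IsRandomWalk G w v₀ P X) {n : ℕ}
    {Q : (ℕ → V) → Prop} (hQ : DependsOnUpTo n Q) : MeasurableSet {ω | Q fun k => X k ω} := by
  rw [setOf_eq_iUnion_cylinder hQ v₀]
  exact MeasurableSet.iUnion fun s => hX.measurableSet_cylinder _ _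

theorem measurable_comp [Countable V] (hX : IsRandomWalk G w v₀ P X) {β : Type*}
    [MeasurableSpace β] (g : V → β) (n : ℕ) : Measurable fun ω => g (X n ω) := by
  intro S _
  have : (fun ω => g (X n ω)) ⁻¹' S = ⋃ v ∈ g ⁻¹' S, {ω | X n ω = v} := by ext; simp
  rw [this]
  exact MeasurableSet.biUnion (Set.to_countable _) fun v _ => hX.measurable n v

/-- The Markov property. -/
theorem measure_and_succ_eq [Countable V] (hX : IsRandomWalk G w v₀ P X)
    (hp : ∀ x y, 0 ≤ transition G w x y) {n : ℕ} {Q : (ℕ → V) → Prop} (hQ : DependsOnUpTo n Q)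
    (y z : V) : P {ω | (Q fun k => X k ω) ∧ X n ω = y ∧ X (n + 1) ω = z} =
      P {ω | (Q fun k => X k ω) ∧ X n ω = y} * ENNReal.ofReal (transition G w y z) := by
  have hQ' : DependsOnUpTo n fun x => Q x ∧ x n = y := fun x x' h hx =>
    ⟨hQ x x' h hx.1, by rw [← h n le_rfl, hx.2]⟩
  -- Padding with the target state `z` lets the same extended path describe the cylinder at time `n`
  -- and its continuation to `z` at time `n + 1`.
  have e1 := setOf_eq_iUnion_cylinder (X := X) hQ' z
  have e2 : {ω | (Q fun k => X k ω) ∧ X n ω = y ∧ X (n + 1) ω = z} =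
      ⋃ s : {s : Fin (n + 1) → V // Q (extendPath s z) ∧ extendPath s z n = y},
      {ω | ∀ k ≤ n + 1, X k ω = extendPath s.1 z k} := by
    have : {ω | (Q fun k => X k ω) ∧ X n ω = y ∧ X (n + 1) ω = z} =
        {ω | (Q fun k => X k ω) ∧ X n ω = y} ∩ {ω | X (n + 1) ω = z} := by
      ext; simp [and_assoc]
    rw [this, e1, Set.iUnion_inter]
    refine Set.iUnion_congr fun s => ?_
    ext ω
    simp only [Set.mem_inter_iff, Set.mem_ofPred_eq]
    constructor
    · rintro ⟨h1, h2⟩ k hk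
      rcases Nat.le_succ_iff.1 hk with hk | rfl
      · exact h1 k hk
      · rw [h2, extendPath_succ]
    · exact fun h => ⟨fun k hk => h k (by omega), by rw [h _ le_rfl, extendPath_succ]⟩
  have hd : ∀ N, n ≤ N → Pairwise (Function.onFun Disjoint
      fun s : {s : Fin (n + 1) → V // Q (extendPath s z) ∧ extendPath s z n = y} =>
        {ω | ∀ k ≤ N, X k ω = extendPath s.1 z k}) := by
    intro N hN s s' hss'
    refine Set.disjoint_left.2 fun ω h h' => hss' (Subtype.ext (funext fun i => ?_))
    have hi : (i : ℕ) ≤ n := Nat.lt_succ_iff.1 i.2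
    have h1 := h i (hi.trans hN)
    rw [h' i (hi.trans hN), extendPath_of_le _ _ hi, extendPath_of_le _ _ hi] at h1
    exact h1.symm
  rw [e1, e2, measure_iUnion (hd n le_rfl) fun s => hX.measurableSet_cylinder _ _,
    measure_iUnion (hd (n + 1) n.le_succ) fun s => hX.measurableSet_cylinder _ _,
    ← ENNReal.tsum_mul_right]
  refine tsum_congr fun s => ?_
  rw [hX.law, hX.law]
  split_ifs
  · rw [Finset.prod_range_succ, ENNReal.ofReal_mul (Finset.prod_nonneg fun _ _ => hp _ _), s.2.2,
      extendPath_succ]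
  · rw [zero_mul]

theorem measureReal_succ_eq [Countable V] [IsProbabilityMeasure P] (hX : IsRandomWalk G w v₀ P X)
    (hp : ∀ x y, 0 ≤ transition G w x y) {n : ℕ} {Q : (ℕ → V) → Prop} (hQ : DependsOnUpTo n Q)
    (z : V) : P.real {ω | (Q fun k => X k ω) ∧ X (n + 1) ω = z} =
      push G w (fun y => P.real {ω | (Q fun k => X k ω) ∧ X n ω = y}) z := by
  have e : {ω | (Q fun k => X k ω) ∧ X (n + 1) ω = z} =
      ⋃ y, {ω | (Q fun k => X k ω) ∧ X n ω = y ∧ X (n + 1) ω = z} := by ext; simp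
  have hmeas : ∀ y, MeasurableSet {ω | (Q fun k => X k ω) ∧ X n ω = y ∧ X (n + 1) ω = z} :=
    fun y => (hX.measurableSet_of_dependsOnUpTo hQ).inter
      ((hX.measurable n y).inter (hX.measurable (n + 1) z))
  have hd : Pairwise (Function.onFun Disjoint
      fun y => {ω | (Q fun k => X k ω) ∧ X n ω = y ∧ X (n + 1) ω = z}) := by
    intro y y' hyy'
    exact Set.disjoint_left.2 fun ω h h' => hyy' (h.2.1.symm.trans h'.2.1)
  rw [measureReal_def, e, measure_iUnion hd hmeas,
    tsum_congr fun y => hX.measure_and_succ_eq hp hQ y z,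
    tsum_eq_sum (s := G.neighborFinset z) fun y hy => ?_, ENNReal.toReal_sum fun y _ => ?_]
  · refine Finset.sum_congr rfl fun y _ => ?_
    rw [ENNReal.toReal_mul, ENNReal.toReal_ofReal (hp _ _)]
    rfl
  · exact ENNReal.mul_ne_top (measure_ne_top _ _) ENNReal.ofReal_ne_top
  · have : ¬ G.Adj y z := fun h => hy (by simpa using h.symm)
    simp [transition, this]

theorem measureReal_eq_occupation [Countable V] [IsProbabilityMeasure P]
    (hX : IsRandomWalk G w v₀ P X) (hw : ∀ e ∈ G.edgeSet, 0 < w e)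
    (hπ : ∀ v, 0 < vertexWeight G w v) (n : ℕ) (x : V) :
    P.real {ω | X n ω = x} = occupation G w v₀ n x := by
  induction n generalizing x with
  | zero =>
    have h := hX.law 0 fun _ => x
    simp only [Nat.le_zero_eq, forall_eq, Finset.range_zero, Finset.prod_empty,
      ENNReal.ofReal_one] at h
    rw [measureReal_def, h]
    by_cases hx : x = v₀
    · simp [occupation, transitionIter, hx, (hπ v₀).ne']
    · simp [occupation, transitionIter, hx]
  | succ n ih =>
    have h := hX.measureReal_succ_eq (transition_nonneg hw hπ) (n := n) (Q := fun _ => True)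
      (fun _ _ _ h => h) x
    simp only [true_and, ih] at h
    rw [h, occupation_succ hπ]

theorem ae_mem_graphBall [Countable V] [IsProbabilityMeasure P] (hX : IsRandomWalk G w v₀ P X)
    (hw : ∀ e ∈ G.edgeSet, 0 < w e) (hπ : ∀ v, 0 < vertexWeight G w v) (n : ℕ) :
    ∀ᵐ ω ∂P, X n ω ∈ graphBall G v₀ n := by
  have : ∀ᵐ ω ∂P, ∀ x, x ∉ graphBall G v₀ n → X n ω ≠ x := by
    rw [ae_all_iff]
    intro x
    by_cases hx : x ∈ graphBall G v₀ n
    · simp [hx]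
    · have h0 : P {ω | X n ω = x} = 0 := by
        rw [← measureReal_eq_zero_iff, hX.measureReal_eq_occupation hw hπ]
        exact not_not.1 (mt mem_graphBall_of_occupation_ne_zero hx)
      have : ∀ᵐ ω ∂P, X n ω ≠ x := by rw [ae_iff]; simpa using h0
      filter_upwards [this] with ω hω _ using hω
  filter_upwards [this] with ω hω
  by_contra h
  exact hω _ h rfl

/-- At time `n` the walk almost surely lies in a finite graph ball, so integrals reduce to finite
sums. -/
theorem setIntegral_comp_eq_sum [Countable V] [IsProbabilityMeasure P]
    (hX : IsRandomWalk G w v₀ P X) (hw : ∀ e ∈ G.edgeSet, 0 < w e)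
    (hπ : ∀ v, 0 < vertexWeight G w v) {n : ℕ} {B : Finset V} (hB : graphBall G v₀ n ⊆ B)
    (f : V → ℝ) (A : Set Ω) :
    ∫ ω in A, f (X n ω) ∂P = ∑ x ∈ B, P.real {ω | ω ∈ A ∧ X n ω = x} * f x := by
  have h1 : ∀ᵐ ω ∂(P.restrict A), f (X n ω) =
      ∑ x ∈ B, {ω | X n ω = x}.indicator (fun _ => f x) ω := by
    refine ae_restrict_of_ae ?_
    filter_upwards [hX.ae_mem_graphBall hw hπ n] with ω hω
    rw [Finset.sum_eq_single_of_mem _ (hB hω) fun x _ hx => ?_]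
    · simp
    · simp [hx.symm]
  rw [integral_congr_ae h1, integral_finsetSum _ fun x _ =>
    (integrable_const _).indicator (hX.measurable n x)]
  refine Finset.sum_congr rfl fun x _ => ?_
  rw [integral_indicator_const _ (hX.measurable n x), smul_eq_mul,
    measureReal_restrict_apply (hX.measurable n x)]
  congr 2
  ext ω
  simp [and_comm]

theorem integrable_comp [Countable V] [IsProbabilityMeasure P]
    (hX : IsRandomWalk G w v₀ P X) {f : V → ℝ} {M : ℝ} (hf : ∀ v, |f v| ≤ M) (n : ℕ) :
    Integrable (fun ω => f (X n ω)) P :=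
  Integrable.of_bound (hX.measurable_comp f n).aestronglyMeasurable M
    (Eventually.of_forall fun _ => hf _)

theorem setIntegral_increment_eq [Countable V] [IsProbabilityMeasure P]
    (hX : IsRandomWalk G w v₀ P X) (hw : ∀ e ∈ G.edgeSet, 0 < w e)
    (hπ : ∀ v, 0 < vertexWeight G w v) {f : V → ℝ} {M : ℝ} (hf : ∀ v, |f v| ≤ M)
    {n : ℕ} {B : Finset V} (hB : graphBall G v₀ (n + 1) ⊆ B) {Q : (ℕ → V) → Prop}
    (hQ : DependsOnUpTo n Q) :
    ∫ ω in {ω | Q fun k => X k ω}, (f (X (n + 1) ω) - f (X n ω)) ∂P =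
      ∑ x ∈ B, P.real {ω | (Q fun k => X k ω) ∧ X n ω = x} *
        (∑ y ∈ G.neighborFinset x, transition G w x y * f y - f x) := by
  rw [integral_sub (hX.integrable_comp hf _).integrableOn (hX.integrable_comp hf _).integrableOn,
    hX.setIntegral_comp_eq_sum hw hπ hB f,
    hX.setIntegral_comp_eq_sum hw hπ ((graphBall_mono n.le_succ).trans hB) f]
  simp only [Set.mem_ofPred_eq, hX.measureReal_succ_eq (transition_nonneg hw hπ) hQ]
  set a : V → ℝ := fun x => P.real {ω | (Q fun k => X k ω) ∧ X n ω = x} with ha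
  have hsupp : ∀ x, a x ≠ 0 → x ∈ graphBall G v₀ n := by
    intro x hx
    refine mem_graphBall_of_occupation_ne_zero (w := w) fun h0 => hx ?_
    rw [← hX.measureReal_eq_occupation hw hπ] at h0
    exact le_antisymm (h0 ▸ measureReal_mono fun ω h => h.2) measureReal_nonneg
  simp only [mul_sub, Finset.sum_sub_distrib]
  congr 1
  have h1 : ∀ z, push G w a z = ∑ x ∈ B, a x * transition G w x z := by
    intro z
    have := sum_neighborFinset_eq (G := G) (w := w) (x := z) (B := B)
      (u := fun x => a x / vertexWeight G w x) fun x _ hx =>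
        hB (graphBall_mono n.le_succ (hsupp x fun h0 => hx (by simp [h0])))
    rw [push]
    convert this using 2 with x _ x _ <;> rw [transition_eq, conductance_comm] <;> ring
  have h2 : ∀ x, a x * ∑ y ∈ G.neighborFinset x, transition G w x y * f y =
      ∑ y ∈ B, a x * transition G w x y * f y := by
    intro x
    by_cases hx : a x = 0
    · simp [hx]
    · simp only [mul_assoc, ← Finset.mul_sum]
      congr 1
      have := sum_neighborFinset_eq (G := G) (w := w) (x := x) (B := B)
        (u := fun y => f y / vertexWeight G w x) fun y hxy _ =>
          hB (mem_graphBall_succ (hsupp x hx) hxy)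
      convert this using 2 with y _ y _ <;> rw [transition_eq] <;> ring
  simp only [h1, Finset.sum_mul]
  rw [Finset.sum_comm]
  exact Finset.sum_congr rfl fun x _ => (h2 x).symm

end IsRandomWalk

/-! ### Green tail and increments up to a stopping time -/

/-- The tail of the Green function at `v₀`, normalized by the vertex weight. -/
def greenTail (G : SimpleGraph V) [G.LocallyFinite] (w : Sym2 V → ℝ) (v₀ : V) (m : ℕ) : ℝ :=
  (∑' j, transitionIter G w (j + 2 * m) v₀ v₀) / vertexWeight G w v₀

theorem tendsto_greenTail (G : SimpleGraph V) [G.LocallyFinite] (w : Sym2 V → ℝ) (v₀ : V) :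
    Tendsto (greenTail G w v₀) atTop (𝓝 0) := by
  have h1 := tendsto_sum_nat_add fun n => transitionIter G w n v₀ v₀
  have h2 : Tendsto (fun m : ℕ => 2 * m) atTop atTop := tendsto_id.const_mul_atTop' two_pos
  have h3 := (h1.comp h2).div_const (vertexWeight G w v₀)
  rw [zero_div] at h3
  exact h3

/-- The expected increment of a function of finite energy along the walk, from time `m` until a
stopping time. -/
theorem IsRandomWalk.abs_sum_setIntegral_le {Ω : Type*} [MeasurableSpace Ω] {P : Measure Ω}
    {X : ℕ → Ω → V} [Countable V] [IsProbabilityMeasure P]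
    (hX : IsRandomWalk G w v₀ P X) (hw : ∀ e ∈ G.edgeSet, 0 < w e)
    (hπ : ∀ v, 0 < vertexWeight G w v) (htrans : IsTransient G w)
    {f : V → ℝ} {M E : ℝ} (hf : ∀ v, |f v| ≤ M) (hE : EnergyLE G w f E)
    {Q : ℕ → (ℕ → V) → Prop} (hQ : ∀ k, DependsOnUpTo k (Q k))
    (hanti : ∀ k x, Q (k + 1) x → Q k x) (m N : ℕ) :
    |∑ k ∈ Finset.Ico m N, ∫ ω in {ω | Q k fun k => X k ω}, (f (X (k + 1) ω) - f (X k ω)) ∂P| ≤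
      Real.sqrt (E * greenTail G w v₀ m) := by
  apply Real.abs_le_sqrt
  rw [Finset.sum_congr rfl fun k hk => hX.setIntegral_increment_eq hw hπ hf
    (B := graphBall G v₀ (N + m + 1)) (graphBall_mono (by rw [Finset.mem_Ico] at hk; omega)) (hQ k)]
  refine sq_sum_increment_le hw hπ (htrans v₀) hE
    (a := fun k x => P.real {ω | (Q k fun k => X k ω) ∧ X k ω = x})
    (fun _ _ => measureReal_nonneg) (fun x => ?_) (fun k _ y => ?_) subset_rfl
  · rw [← hX.measureReal_eq_occupation hw hπ]
    exact measureReal_mono fun ω h => h.2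
  · rw [← hX.measureReal_succ_eq (transition_nonneg hw hπ) (hQ k)]
    exact measureReal_mono fun ω h => ⟨hanti k _ h.1, h.2⟩

end

/-! ### Crossings, convergence and absence of atoms -/

section

variable {V : Type*}

/-- The sequence `g ∘ x` goes from `0` to `1` between the times `m` and `n`. -/
def Crosses (g : V → ℝ) (m n : ℕ) (x : ℕ → V) : Prop :=
  ∃ i j, m ≤ i ∧ i ≤ j ∧ j ≤ n ∧ g (x i) = 0 ∧ g (x j) = 1

/-- The sequence `g ∘ x` vanishes at some time between `m` and `n`. -/
def Vanishes (g : V → ℝ) (m n : ℕ) (x : ℕ → V) : Prop :=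
  ∃ i, m ≤ i ∧ i ≤ n ∧ g (x i) = 0

theorem Crosses.vanishes {g : V → ℝ} {m n : ℕ} {x : ℕ → V} (h : Crosses g m n x) :
    Vanishes g m n x := by
  obtain ⟨i, j, h1, h2, h3, h4, -⟩ := h
  exact ⟨i, h1, h2.trans h3, h4⟩

theorem Crosses.mono {g : V → ℝ} {m n n' : ℕ} {x : ℕ → V} (h : Crosses g m n x) (hn : n ≤ n') :
    Crosses g m n' x := by
  obtain ⟨i, j, h1, h2, h3, h4⟩ := h
  exact ⟨i, j, h1, h2, h3.trans hn, h4⟩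

theorem Vanishes.mono {g : V → ℝ} {m n n' : ℕ} {x : ℕ → V} (h : Vanishes g m n x) (hn : n ≤ n') :
    Vanishes g m n' x := by
  obtain ⟨i, h1, h2, h3⟩ := h
  exact ⟨i, h1, h2.trans hn, h3⟩

theorem dependsOnUpTo_not_crosses (g : V → ℝ) (m n : ℕ) :
    DependsOnUpTo n fun x => ¬ Crosses g m n x := by
  rintro x x' h hx ⟨i, j, h1, h2, h3, h4, h5⟩
  exact hx ⟨i, j, h1, h2, h3, by rw [h i (h2.trans h3), h4], by rw [h j h3, h5]⟩

theorem dependsOnUpTo_not_vanishes (g : V → ℝ) (m n : ℕ) :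
    DependsOnUpTo n fun x => ¬ Vanishes g m n x := by
  rintro x x' h hx ⟨i, h1, h2, h3⟩
  exact hx ⟨i, h1, h2, by rw [h i h2, h3]⟩

-- The difference of the two terms keeps exactly the increments after the first zero and before the
-- next value 1. It telescopes to 1 on a completed crossing and to the current value of `g` on an
-- unfinished one. Both cutoffs are stopping rules, which is why the sum is split this way.
open Classical in
theorem sum_increment_between (g : V → ℝ) {m n : ℕ} (hmn : m ≤ n) (x : ℕ → V) :
    ∑ k ∈ Finset.Ico m n, ((if ¬ Crosses g m k x then g (x (k + 1)) - g (x k) else 0) -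
      (if ¬ Vanishes g m k x then g (x (k + 1)) - g (x k) else 0)) =
      if Crosses g m n x then 1 else if Vanishes g m n x then g (x n) else 0 := by
  induction n, hmn using Nat.le_induction with
  | base =>
    have h1 : ¬ Crosses g m m x := by
      rintro ⟨i, j, h1, h2, h3, h4, h5⟩
      obtain rfl : i = j := by omega
      rw [h4] at h5; norm_num at h5
    rw [if_neg h1]
    split_ifs with h
    · obtain ⟨i, h1, h2, h3⟩ := h
      obtain rfl : i = m := by omega
      simp [h3]
    · simp
  | succ n hmn ih =>
    rw [Finset.sum_Ico_succ_top hmn, ih]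
    by_cases hc : Crosses g m n x
    · simp [hc, hc.vanishes, hc.mono n.le_succ]
    by_cases hv : Vanishes g m n x
    · have hv' := hv.mono n.le_succ
      have hiff : Crosses g m (n + 1) x ↔ g (x (n + 1)) = 1 := by
        constructor
        · rintro ⟨i, j, h1, h2, h3, h4, h5⟩
          rcases Nat.le_succ_iff.1 h3 with h3 | rfl
          · exact absurd ⟨i, j, h1, h2, h3, h4, h5⟩ hc
          · exact h5
        · intro h
          obtain ⟨i, h1, h2, h3⟩ := hv
          exact ⟨i, n + 1, h1, by omega, le_rfl, h3, h⟩
      by_cases h1 : g (x (n + 1)) = 1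
      · simp [hc, hv, hiff, h1]
      · simp [hc, hv, hv', hiff, h1]
    · have hc' : ¬ Crosses g m (n + 1) x := by
        rintro ⟨i, j, h1, h2, h3, h4, h5⟩
        by_cases hi : i ≤ n
        · exact hv ⟨i, h1, hi, h4⟩
        · obtain rfl : i = j := by omega
          rw [h4] at h5; norm_num at h5
      by_cases hv' : Vanishes g m (n + 1) x
      · have : g (x (n + 1)) = 0 := by
          obtain ⟨i, h1, h2, h3⟩ := hv'
          rcases Nat.le_succ_iff.1 h2 with h2 | rfl
          · exact absurd ⟨i, h1, h2, h3⟩ hv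
          · exact h3
        simp [hc, hv, hc', hv', this]
      · simp [hc, hv, hc', hv']

/-- The affine map taking `a` to `0` and `b` to `1`, truncated to `[0, 1]`. -/
def ramp (a b t : ℝ) : ℝ := max 0 (min 1 ((t - a) / (b - a)))

theorem ramp_nonneg (a b t : ℝ) : 0 ≤ ramp a b t := le_max_left _ _

theorem ramp_le_one (a b t : ℝ) : ramp a b t ≤ 1 := max_le zero_le_one (min_le_left _ _)

theorem ramp_eq_zero {a b t : ℝ} (hab : a < b) (h : t ≤ a) : ramp a b t = 0 :=
  max_eq_left ((min_le_right _ _).trans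
    (div_nonpos_of_nonpos_of_nonneg (by linarith) (by linarith)))

theorem ramp_eq_one {a b t : ℝ} (hab : a < b) (h : b ≤ t) : ramp a b t = 1 := by
  have : 1 ≤ (t - a) / (b - a) := by rw [le_div_iff₀ (by linarith)]; linarith
  rw [ramp, min_eq_left this, max_eq_right zero_le_one]

theorem abs_ramp_sub_ramp_le {a b : ℝ} (hab : a < b) (s t : ℝ) :
    |ramp a b s - ramp a b t| ≤ (b - a)⁻¹ * |s - t| := by
  have h1 : |ramp a b s - ramp a b t| ≤ |(s - a) / (b - a) - (t - a) / (b - a)| :=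
    (abs_max_sub_max_le_max _ _ _ _).trans (max_le (by simp)
      ((abs_min_sub_min_le_max _ _ _ _).trans (max_le (by simp) le_rfl)))
  refine h1.trans (le_of_eq ?_)
  rw [← sub_div, abs_div, abs_of_pos (show 0 < b - a by linarith), sub_sub_sub_cancel_right,
    div_eq_inv_mul]

variable {G : SimpleGraph V} [G.LocallyFinite] {w : Sym2 V → ℝ} {v₀ : V}
  {Ω : Type*} [MeasurableSpace Ω] {P : Measure Ω} {X : ℕ → Ω → V}

namespace IsRandomWalk

/-- Integrate `sum_increment_between`: the unfinished crossings contribute nonnegatively, and each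
of the two stopping rules costs one energy bound, hence the factor 2. -/
theorem measureReal_crosses_le [Countable V] [IsProbabilityMeasure P]
    (hX : IsRandomWalk G w v₀ P X) (hw : ∀ e ∈ G.edgeSet, 0 < w e)
    (hπ : ∀ v, 0 < vertexWeight G w v) (htrans : IsTransient G w)
    {g : V → ℝ} {E : ℝ} (hg0 : ∀ v, 0 ≤ g v) (hg1 : ∀ v, g v ≤ 1) (hE : EnergyLE G w g E)
    {m n : ℕ} (hmn : m ≤ n) :
    P.real {ω | Crosses g m n fun k => X k ω} ≤ 2 * Real.sqrt (E * greenTail G w v₀ m) := by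
  classical
  have hg : ∀ v, |g v| ≤ 1 := fun v => (abs_of_nonneg (hg0 v)).trans_le (hg1 v)
  have hC := hX.abs_sum_setIntegral_le hw hπ htrans hg hE
    (Q := fun k x => ¬ Crosses g m k x) (dependsOnUpTo_not_crosses g m)
    (fun k x h h' => h (h'.mono k.le_succ)) m n
  have hV := hX.abs_sum_setIntegral_le hw hπ htrans hg hE
    (Q := fun k x => ¬ Vanishes g m k x) (dependsOnUpTo_not_vanishes g m)
    (fun k x h h' => h (h'.mono k.le_succ)) m n
  have hmC : ∀ k, MeasurableSet {ω | ¬ Crosses g m k fun k => X k ω} := fun k =>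
    hX.measurableSet_of_dependsOnUpTo (dependsOnUpTo_not_crosses g m k)
  have hmV : ∀ k, MeasurableSet {ω | ¬ Vanishes g m k fun k => X k ω} := fun k =>
    hX.measurableSet_of_dependsOnUpTo (dependsOnUpTo_not_vanishes g m k)
  have hmC' : MeasurableSet {ω | Crosses g m n fun k => X k ω} := by
    have := (hmC n).compl
    rwa [show {ω | ¬ Crosses g m n fun k => X k ω}ᶜ = {ω | Crosses g m n fun k => X k ω} by
      ext; simp] at this
  have hint : ∀ k, Integrable (fun ω => g (X (k + 1) ω) - g (X k ω)) P := fun k =>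
    (hX.integrable_comp hg _).sub (hX.integrable_comp hg _)
  have hintC := fun k => (hint k).indicator (hmC k)
  have hintV := fun k => (hint k).indicator (hmV k)
  have hsub : ∀ k, Integrable (fun ω => {ω | ¬ Crosses g m k fun k => X k ω}.indicator
        (fun ω => g (X (k + 1) ω) - g (X k ω)) ω -
      {ω | ¬ Vanishes g m k fun k => X k ω}.indicator
        (fun ω => g (X (k + 1) ω) - g (X k ω)) ω) P := fun k => (hintC k).sub (hintV k)
  have hle : P.real {ω | Crosses g m n fun k => X k ω} ≤ ∫ ω, ∑ k ∈ Finset.Ico m n,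
      ({ω | ¬ Crosses g m k fun k => X k ω}.indicator
        (fun ω => g (X (k + 1) ω) - g (X k ω)) ω -
      {ω | ¬ Vanishes g m k fun k => X k ω}.indicator
        (fun ω => g (X (k + 1) ω) - g (X k ω)) ω) ∂P := by
    rw [← integral_indicator_one hmC']
    refine integral_mono ((integrable_const (1 : ℝ)).indicator hmC')
      (integrable_finsetSum _ fun k _ => hsub k) fun ω => ?_
    have := sum_increment_between g hmn fun k => X k ω
    simp only [Set.indicator_apply, Set.mem_ofPred_eq, Pi.one_apply]
    rw [this]
    split_ifs
    · exact le_rfl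
    · exact hg0 _
    · exact le_rfl
  rw [integral_finsetSum _ fun k _ => hsub k] at hle
  rw [Finset.sum_congr rfl fun k _ => integral_sub (hintC k) (hintV k),
    Finset.sum_sub_distrib] at hle
  simp only [fun k => integral_indicator (μ := P) (f := fun ω => g (X (k + 1) ω) - g (X k ω))
    (hmC k), fun k => integral_indicator (μ := P) (f := fun ω => g (X (k + 1) ω) - g (X k ω))
    (hmV k)] at hle
  linarith [le_abs_self (∑ k ∈ Finset.Ico m n,
    ∫ ω in {ω | ¬ Crosses g m k fun k => X k ω}, (g (X (k + 1) ω) - g (X k ω)) ∂P),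
    neg_abs_le (∑ k ∈ Finset.Ico m n,
    ∫ ω in {ω | ¬ Vanishes g m k fun k => X k ω}, (g (X (k + 1) ω) - g (X k ω)) ∂P)]

/-- A function of finite energy crosses an interval only finitely often along the walk. -/
theorem ae_exists_not_crosses [Countable V] [IsProbabilityMeasure P]
    (hX : IsRandomWalk G w v₀ P X) (hw : ∀ e ∈ G.edgeSet, 0 < w e)
    (hπ : ∀ v, 0 < vertexWeight G w v) (htrans : IsTransient G w)
    {g : V → ℝ} {E : ℝ} (hg0 : ∀ v, 0 ≤ g v) (hg1 : ∀ v, g v ≤ 1) (hE : EnergyLE G w g E) :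
    ∀ᵐ ω ∂P, ∃ m, ∀ n, ¬ Crosses g m n fun k => X k ω := by
  have hbound : ∀ m, P {ω | ∃ n, Crosses g m n fun k => X k ω} ≤
      ENNReal.ofReal (2 * Real.sqrt (E * greenTail G w v₀ m)) := by
    intro m
    have e : {ω | ∃ n, Crosses g m n fun k => X k ω} =
        -- The shift by `m` meets the requirement that the final time be at least `m`.
        ⋃ n, {ω | Crosses g m (m + n) fun k => X k ω} := by
      ext ω
      simp only [Set.mem_ofPred_eq, Set.mem_iUnion]
      exact ⟨fun ⟨n, hn⟩ => ⟨n, hn.mono (by omega)⟩, fun ⟨n, hn⟩ => ⟨_, hn⟩⟩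
    have hmono : Monotone fun n => {ω | Crosses g m (m + n) fun k => X k ω} :=
      fun n n' h ω hω => Crosses.mono hω (by omega)
    rw [e, hmono.measure_iUnion]
    refine iSup_le fun n => ?_
    rw [← ofReal_measureReal]
    exact ENNReal.ofReal_le_ofReal
      (hX.measureReal_crosses_le hw hπ htrans hg0 hg1 hE (Nat.le_add_right m n))
  have hlim : Tendsto (fun m => ENNReal.ofReal (2 * Real.sqrt (E * greenTail G w v₀ m))) atTop
      (𝓝 0) := by
    have h1 : Tendsto (fun m => 2 * Real.sqrt (E * greenTail G w v₀ m)) atTop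
        (𝓝 (2 * Real.sqrt (E * 0))) :=
      ((((tendsto_greenTail G w v₀).const_mul E)).sqrt).const_mul 2
    simpa using ENNReal.tendsto_ofReal h1
  rw [ae_iff]
  refine le_antisymm (ge_of_tendsto' hlim fun m => ?_) (zero_le)
  refine (measure_mono fun ω hω => ?_).trans (hbound m)
  simp only [Set.mem_ofPred_eq, not_exists, not_forall, not_not] at hω ⊢
  exact hω m

/-- A bounded sequence that oscillated would pass infinitely often from below `a` to above `b` for
some rationals `a < b`, and `ramp` turns each passage into a crossing from 0 to 1. -/
theorem ae_exists_tendsto [Countable V] [IsProbabilityMeasure P]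
    (hX : IsRandomWalk G w v₀ P X) (hw : ∀ e ∈ G.edgeSet, 0 < w e)
    (hπ : ∀ v, 0 < vertexWeight G w v) (htrans : IsTransient G w) {f : V → ℝ} {M : ℝ}
    (hf : ∀ v, |f v| ≤ M)
    (hE : ∀ a b : ℝ, a < b → ∃ E, EnergyLE G w (fun v => ramp a b (f v)) E) :
    ∀ᵐ ω ∂P, ∃ c, Tendsto (fun n => f (X n ω)) atTop (𝓝 c) := by
  have h : ∀ᵐ ω ∂P, ∀ a b : ℚ, (a : ℝ) < b →
      ∃ m, ∀ n, ¬ Crosses (fun v => ramp a b (f v)) m n fun k => X k ω := by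
    rw [ae_all_iff]; intro a
    rw [ae_all_iff]; intro b
    by_cases hab : (a : ℝ) < b
    · obtain ⟨E, hE⟩ := hE a b hab
      filter_upwards [hX.ae_exists_not_crosses hw hπ htrans (fun v => ramp_nonneg _ _ _)
        (fun v => ramp_le_one _ _ _) hE] with ω hω _ using hω
    · simp [hab]
  filter_upwards [h] with ω hω
  refine tendsto_of_no_upcrossings Rat.denseRange_cast ?_
    (isBoundedUnder_of ⟨M, fun n => (abs_le.1 (hf _)).2⟩)
    (isBoundedUnder_of ⟨-M, fun n => (abs_le.1 (hf _)).1⟩)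
  rintro _ ⟨a, rfl⟩ _ ⟨b, rfl⟩ hab ⟨h1, h2⟩
  obtain ⟨m, hm⟩ := hω a b hab
  obtain ⟨i, hi, hia⟩ := (frequently_atTop.1 h1) m
  obtain ⟨j, hj, hjb⟩ := (frequently_atTop.1 h2) i
  exact hm j ⟨i, j, hi, hj, le_rfl, ramp_eq_zero hab hia.le, ramp_eq_one hab hjb.le⟩

theorem integral_le_integral_add [Countable V] [IsProbabilityMeasure P]
    (hX : IsRandomWalk G w v₀ P X) (hw : ∀ e ∈ G.edgeSet, 0 < w e)
    (hπ : ∀ v, 0 < vertexWeight G w v) (htrans : IsTransient G w) {f : V → ℝ} {M E : ℝ}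
    (hf : ∀ v, |f v| ≤ M) (hE : EnergyLE G w f E) {m n : ℕ} (hmn : m ≤ n) :
    ∫ ω, f (X n ω) ∂P ≤ ∫ ω, f (X m ω) ∂P + Real.sqrt (E * greenTail G w v₀ m) := by
  have h := hX.abs_sum_setIntegral_le hw hπ htrans hf hE (Q := fun _ _ => True)
    (fun _ _ _ _ h => h) (fun _ _ h => h) m n
  have e : ∀ k, ∫ ω in {ω : Ω | True}, (f (X (k + 1) ω) - f (X k ω)) ∂P =
      ∫ ω, f (X (k + 1) ω) ∂P - ∫ ω, f (X k ω) ∂P := by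
    intro k
    rw [Set.ofPred_true, Measure.restrict_univ,
      integral_sub (hX.integrable_comp hf _) (hX.integrable_comp hf _)]
  simp only [e] at h
  rw [Finset.sum_Ico_sub (fun k => ∫ ω, f (X k ω) ∂P) hmn] at h
  linarith [le_abs_self (∫ ω, f (X n ω) ∂P - ∫ ω, f (X m ω) ∂P)]

/-- Borel–Cantelli applied to the summable occupation probabilities. -/
theorem ae_eventually_ne [Countable V] [IsProbabilityMeasure P]
    (hX : IsRandomWalk G w v₀ P X) (hconn : G.Connected) (hw : ∀ e ∈ G.edgeSet, 0 < w e)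
    (hπ : ∀ v, 0 < vertexWeight G w v) (htrans : IsTransient G w) :
    ∀ᵐ ω ∂P, ∀ v, ∀ᶠ n in atTop, X n ω ≠ v := by
  rw [ae_all_iff]
  intro v
  have hsum : ∑' n, P {ω | X n ω = v} ≠ ⊤ := by
    have h1 : ∀ n, P {ω | X n ω = v} = ENNReal.ofReal (occupation G w v₀ n v) := fun n => by
      rw [← hX.measureReal_eq_occupation hw hπ, ofReal_measureReal]
    simp only [h1]
    exact (summable_occupation hconn hw hπ htrans v₀ v).tsum_ofReal_ne_top
  exact ae_eventually_notMem hsum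

/-- A point whose neighbourhoods support cutoff functions of uniformly bounded energy is not
charged by the limit of the walk. -/
theorem measure_tendsto_eq_zero [Countable V] [IsProbabilityMeasure P]
    (hX : IsRandomWalk G w v₀ P X) (hw : ∀ e ∈ G.edgeSet, 0 < w e)
    (hπ : ∀ v, 0 < vertexWeight G w v) (htrans : IsTransient G w) {ρ : V → ℝ}
    (hρ : ∀ v, 0 < ρ v) {E : ℝ}
    (hE : ∀ r > 0, EnergyLE G w (fun v => 1 - ramp r (2 * r) (ρ v)) E) :
    P {ω | Tendsto (fun n => ρ (X n ω)) atTop (𝓝 0)} = 0 := by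
  have hlim : Tendsto (fun m => ENNReal.ofReal (Real.sqrt (E * greenTail G w v₀ m))) atTop
      (𝓝 0) := by
    have h1 : Tendsto (fun m => Real.sqrt (E * greenTail G w v₀ m)) atTop
        (𝓝 (Real.sqrt (E * 0))) :=
      (((tendsto_greenTail G w v₀).const_mul E)).sqrt
    simpa using ENNReal.tendsto_ofReal h1
  refine le_antisymm (ge_of_tendsto' hlim fun m => ?_) (zero_le)
  -- The radius depends on `m` so that the cutoff vanishes wherever the walk can be at time `m`;
  -- this is harmless because the energy bound does not depend on `r`.
  obtain ⟨r, hr, hrB⟩ : ∃ r > 0, ∀ v ∈ graphBall G v₀ m, 2 * r ≤ ρ v := by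
    have hne : (graphBall G v₀ m).Nonempty :=
      ⟨v₀, graphBall_mono (Nat.zero_le m) (Finset.mem_singleton_self v₀)⟩
    obtain ⟨u, -, hu⟩ := (graphBall G v₀ m).exists_min_image ρ hne
    exact ⟨ρ u / 2, half_pos (hρ u), fun v hv => by linarith [hu v hv]⟩
  set φ : V → ℝ := fun v => 1 - ramp r (2 * r) (ρ v) with hφ
  have hφ0 : ∀ v, 0 ≤ φ v := fun v => sub_nonneg.2 (ramp_le_one _ _ _)
  have hφ1 : ∀ v, |φ v| ≤ 1 := fun v => by
    rw [abs_of_nonneg (hφ0 v)]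
    linarith [ramp_nonneg r (2 * r) (ρ v)]
  have hm : ∫ ω, φ (X m ω) ∂P = 0 := by
    refine integral_eq_zero_of_ae ?_
    filter_upwards [hX.ae_mem_graphBall hw hπ m] with ω hω
    simp only [hφ, Pi.zero_apply]
    rw [ramp_eq_one (by linarith) (hrB _ hω), sub_self]
  have hn : ∀ n, m ≤ n → P {ω | ρ (X n ω) ≤ r} ≤
      ENNReal.ofReal (Real.sqrt (E * greenTail G w v₀ m)) := by
    intro n hmn
    have hmeas : MeasurableSet {ω | ρ (X n ω) ≤ r} :=
      measurableSet_le (hX.measurable_comp ρ n) measurable_const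
    rw [← ofReal_measureReal]
    refine ENNReal.ofReal_le_ofReal ?_
    have h1 := hX.integral_le_integral_add hw hπ htrans hφ1 (hE r hr) hmn
    rw [hm, zero_add] at h1
    refine le_trans ?_ h1
    rw [← integral_indicator_one hmeas]
    refine integral_mono ((integrable_const (1 : ℝ)).indicator hmeas)
      (hX.integrable_comp hφ1 n) fun ω => ?_
    by_cases hω : ρ (X n ω) ≤ r
    · simp [hφ, hω, ramp_eq_zero (show r < 2 * r by linarith) hω]
    · simpa [hω] using hφ0 _
  have hsub : {ω | Tendsto (fun n => ρ (X n ω)) atTop (𝓝 0)} ⊆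
      ⋃ n, {ω | ∀ k, m + n ≤ k → ρ (X k ω) ≤ r} := by
    intro ω hω
    obtain ⟨n, hn⟩ := eventually_atTop.1 ((Tendsto.eventually_lt_const hr hω))
    exact Set.mem_iUnion.2 ⟨n, fun k hk => (hn k (by omega)).le⟩
  have hmono : Monotone fun n => {ω | ∀ k, m + n ≤ k → ρ (X k ω) ≤ r} :=
    fun n n' h ω hω k hk => hω k (by omega)
  refine (measure_mono hsub).trans ?_
  rw [hmono.measure_iUnion]
  refine iSup_le fun n => (measure_mono fun ω hω => ?_).trans (hn (m + n) (Nat.le_add_right _ _))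
  exact hω _ le_rfl

end IsRandomWalk

end

/-! ### Non-accumulation of vertices and conclusion -/

section

variable {V : Type*} {G : SimpleGraph V} {pos : V → ℂ}

theorem vertexWeight_pos [G.LocallyFinite] {w : Sym2 V → ℝ} (hw : ∀ e ∈ G.edgeSet, 0 < w e)
    {v : V} (hv : ∃ u, G.Adj v u) : 0 < vertexWeight G w v := by
  obtain ⟨u, hu⟩ := hv
  exact Finset.sum_pos (fun u hu => hw _ (G.mem_edgeSet.2 (by simpa using hu)))
    ⟨u, by simpa using hu⟩

/-- The vertices do not accumulate in the carrier. -/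
theorem IsGoodWith.exists_nhds_finite {D η : ℝ} (h : IsGoodWith G pos D η)
    (hadj : ∀ v, ∃ u, G.Adj v u) {z : ℂ} (hz : z ∈ carrier G pos) :
    ∃ N ∈ 𝓝 z, {v | pos v ∈ N}.Finite := by
  obtain ⟨F, hF, hzF⟩ := mem_carrier_iff.1 hz
  choose nb hnb using hadj
  by_cases hzF' : z ∈ F
  · refine ⟨F, hF.isOpen.mem_nhds hzF', ?_⟩
    convert Set.finite_empty
    ext v
    simp only [Set.mem_ofPred_eq, Set.mem_empty_iff_false, iff_false]
    exact fun hv => hF.subset_compl hv (segment_subset_drawing (hnb v) (left_mem_segment _ _ _))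
  · have hzd : z ∈ drawing G pos := hF.2 (by rw [hF.isOpen.frontier_eq]; exact ⟨hzF, hzF'⟩)
    obtain ⟨N, hN, hfin⟩ := h.straight.locallyFinite z hzd
    refine ⟨N, hN, ?_⟩
    have hfin2 : (⋃ e ∈ {e ∈ G.edgeSet | (edgeSegment pos e ∩ N).Nonempty}, {v | v ∈ e}).Finite := by
      refine hfin.biUnion fun e _ => ?_
      induction e with
      | h a b =>
        have : {x | x ∈ s(a, b)} = ({a, b} : Set V) := by ext x; simp
        rw [this]; exact Set.toFinite _
    refine hfin2.subset fun v hv => ?_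
    refine Set.mem_biUnion (x := s(v, nb v)) ⟨G.mem_edgeSet.2 (hnb v), pos v, ?_, hv⟩ (by simp)
    rw [edgeSegment_mk]
    exact left_mem_segment _ _ _

theorem exists_boundary_limit {V : Type*} (G : SimpleGraph V) [G.LocallyFinite] (hconn : G.Connected)
    (hdeg : ∃ d : ℕ, ∀ v, G.degree v ≤ d)
    (pos : V → ℂ) (hgood : IsGood G pos)
    (hcarr : carrier G pos = Metric.ball (0 : ℂ) 1)
    (w : Sym2 V → ℝ) (hw : ∃ a b : ℝ, 0 < a ∧ ∀ e ∈ G.edgeSet, a ≤ w e ∧ w e ≤ b)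
    (htrans : IsTransient G w)
    {Ω : Type*} [MeasurableSpace Ω] (P : Measure Ω) [IsProbabilityMeasure P]
    (v₀ : V) (X : ℕ → Ω → V) (hX : IsRandomWalk G w v₀ P X) :
    ∃ Xlim : Ω → ℂ, Measurable Xlim ∧
      (∀ᵐ ω ∂P, Xlim ω ∈ frontier (Metric.ball (0 : ℂ) 1) ∧
        Tendsto (fun n => pos (X n ω)) atTop (𝓝 (Xlim ω))) ∧
      ∀ ξ : ℂ, P.map Xlim {ξ} = 0 := by

  classical
  obtain ⟨d, hd⟩ := hdeg
  obtain ⟨D, η, hgood⟩ := hgood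
  obtain ⟨a, b, ha, hab⟩ := hw
  have hopen : IsOpen (carrier G pos) := hcarr ▸ Metric.isOpen_ball
  have hne : (carrier G pos).Nonempty := hcarr ▸ ⟨0, by simp⟩
  have hadj := exists_adj_of_isGoodWith hgood hconn hne
  have hU : ∀ v, pos v ∈ Metric.ball (0 : ℂ) 1 := fun v =>
    hcarr ▸ hgood.pos_mem_carrier hconn hopen hne v
  have hU' : ∀ v, ‖pos v‖ ≤ 1 := fun v => (mem_ball_zero_iff.1 (hU v)).le
  have hwpos : ∀ e ∈ G.edgeSet, 0 < w e := fun e he => ha.trans_le (hab e he).1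
  have hwb : ∀ e ∈ G.edgeSet, 0 ≤ w e ∧ w e ≤ |b| := fun e he =>
    ⟨(hwpos e he).le, (hab e he).2.trans (le_abs_self b)⟩
  have hπ : ∀ v, 0 < vertexWeight G w v := fun v => vertexWeight_pos hwpos (hadj v)
  have : Countable V := countable_of_connected hconn
  obtain ⟨s, C, hC, hs, hsC, hsξ⟩ := exists_edge_scale hgood hconn hcarr
  have henergy : ∀ f : V → ℝ, (∀ x y, |f x - f y| ≤ dist (pos x) (pos y)) → ∀ a b : ℝ, a < b →
      ∃ E, EnergyLE G w (fun v => ramp a b (f v)) E := by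
    intro f hf a b hab
    refine ⟨_, energyLE_of_lipschitz hd hwb hs (abs_nonneg _) (T := Set.univ) (L := (b - a)⁻¹)
      (M := C) (fun x y _ => ?_) (inv_nonneg.2 (sub_nonneg.2 hab.le)) (by simp) fun B _ => hsC B⟩
    refine (abs_ramp_sub_ramp_le hab _ _).trans ?_
    rw [dist_comm]
    exact mul_le_mul_of_nonneg_left (hf y x) (inv_nonneg.2 (sub_nonneg.2 hab.le))
  have hre := hX.ae_exists_tendsto hwpos hπ htrans (f := fun v => (pos v).re) (M := 1)
    (fun v => (Complex.abs_re_le_norm _).trans (hU' v)) (henergy _ fun x y => by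
      rw [← Complex.sub_re, dist_eq_norm]; exact Complex.abs_re_le_norm _)
  have him := hX.ae_exists_tendsto hwpos hπ htrans (f := fun v => (pos v).im) (M := 1)
    (fun v => (Complex.abs_im_le_norm _).trans (hU' v)) (henergy _ fun x y => by
      rw [← Complex.sub_im, dist_eq_norm]; exact Complex.abs_im_le_norm _)
  have hlim : ∀ᵐ ω ∂P, ∃ z : ℂ, Tendsto (fun n => pos (X n ω)) atTop (𝓝 z) := by
    filter_upwards [hre, him] with ω ⟨x, hx⟩ ⟨y, hy⟩
    refine ⟨x + y * Complex.I, ?_⟩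
    have h1 := ((Complex.continuous_ofReal.tendsto x).comp hx).add
      (((Complex.continuous_ofReal.tendsto y).comp hy).mul_const Complex.I)
    simpa [Function.comp_def, Complex.re_add_im] using h1
  obtain ⟨Xlim, hmeas, hXlim⟩ := measurable_limit_of_tendsto_metrizable_ae
    (fun n => (hX.measurable_comp pos n).aemeasurable) hlim
  have hae : ∀ᵐ ω ∂P, Xlim ω ∈ frontier (Metric.ball (0 : ℂ) 1) ∧
      Tendsto (fun n => pos (X n ω)) atTop (𝓝 (Xlim ω)) := by
    filter_upwards [hXlim, hX.ae_eventually_ne hconn hwpos hπ htrans] with ω hω hleave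
    refine ⟨?_, hω⟩
    rw [Metric.isOpen_ball.frontier_eq]
    refine ⟨mem_closure_of_tendsto hω (Eventually.of_forall fun n => hU _), fun hball => ?_⟩
    -- A limit inside the disc would keep the walk among finitely many vertices, each of which it
    -- eventually leaves.
    obtain ⟨N, hN, hfin⟩ := hgood.exists_nhds_finite hadj (hcarr ▸ hball)
    have h1 : ∀ᶠ n in atTop, ∀ v ∈ {v | pos v ∈ N}, X n ω ≠ v :=
      (eventually_all_finite hfin).2 fun v _ => hleave v
    obtain ⟨n, h1n, h2n⟩ := (h1.and (hω.eventually hN)).exists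
    exact h1n _ h2n rfl
  refine ⟨Xlim, hmeas, hae, fun ξ => ?_⟩
  rw [Measure.map_apply hmeas (measurableSet_singleton ξ)]
  by_cases hξ : ξ ∈ Metric.ball (0 : ℂ) 1
  · have h1 : ∀ᵐ ω ∂P, Xlim ω ≠ ξ := by
      filter_upwards [hae] with ω hω heq
      rw [Metric.isOpen_ball.frontier_eq] at hω
      exact hω.1.2 (heq ▸ hξ)
    have h2 := ae_iff.1 h1
    simp only [ne_eq, not_not] at h2
    exact h2
  · have hzero := hX.measure_tendsto_eq_zero hwpos hπ htrans (ρ := fun v => dist (pos v) ξ)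
      -- The 4 is r⁻² · (2r)²: squared slope times squared radius of the support, so the energy is
      -- scale invariant.
      (fun v => dist_pos.2 fun h => hξ (h ▸ hU v)) (E := 2 * (d * (|b| * (C * 4))))
      fun r hr => by
        have h1 := energyLE_of_lipschitz hd hwb hs (abs_nonneg _) (T := {v | dist (pos v) ξ < 2 * r})
          (L := r⁻¹) (M := C * (2 * r) ^ 2)
          (f := fun v => 1 - ramp r (2 * r) (dist (pos v) ξ)) (fun x y _ => ?_)
          (inv_nonneg.2 hr.le) (fun x y hx hy => ?_) fun B hB => hsξ ξ hξ (2 * r) (by linarith) B hB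
        · convert h1 using 1
          field_simp
          ring
        · rw [sub_sub_sub_cancel_left]
          refine (abs_ramp_sub_ramp_le (by linarith) _ _).trans ?_
          rw [show 2 * r - r = r by ring]
          exact mul_le_mul_of_nonneg_left (abs_dist_sub_le _ _ _) (inv_nonneg.2 hr.le)
        · simp only [Set.mem_ofPred_eq, not_lt] at hx hy
          rw [ramp_eq_one (by linarith) hx, ramp_eq_one (by linarith) hy]
    refine measure_mono_null_ae ?_ hzero
    filter_upwards [hae] with ω hω heq
    exact (tendsto_iff_dist_tendsto_zero.1 (heq ▸ hω.2))

end

end GoodEmbedding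

end

theorem propositionP {V : Type*} (G : SimpleGraph V) [G.LocallyFinite] (hconn : G.Connected)
    (hdeg : ∃ d : ℕ, ∀ v, G.degree v ≤ d)
    (pos : V → ℂ) (hgood : GoodEmbedding.IsGood G pos)
    (hcarr : GoodEmbedding.carrier G pos = Metric.ball (0 : ℂ) 1)
    (w : Sym2 V → ℝ) (hw : ∃ a b : ℝ, 0 < a ∧ ∀ e ∈ G.edgeSet, a ≤ w e ∧ w e ≤ b)
    (htrans : GoodEmbedding.IsTransient G w)
    {Ω : Type*} [MeasurableSpace Ω] (P : Measure Ω) [IsProbabilityMeasure P]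
    (v₀ : V) (X : ℕ → Ω → V) (hX : GoodEmbedding.IsRandomWalk G w v₀ P X) :
    ∃ Xlim : Ω → ℂ, Measurable Xlim ∧
      (∀ᵐ ω ∂P, Xlim ω ∈ frontier (Metric.ball (0 : ℂ) 1) ∧
        Tendsto (fun n => pos (X n ω)) atTop (𝓝 (Xlim ω))) ∧
      ∀ ξ : ℂ, P.map Xlim {ξ} = 0 := by
  exact GoodEmbedding.exists_boundary_limit G hconn hdeg pos hgood hcarr w hw htrans P v₀ X hX
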